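/- Compose maps and morphisms from left to right. All categories below are small. **Normal categories.** A category with subobjects is a category $\mathcal C$ with a partial order $\subseteq$ on its objects realized by monomorphisms $j(c,d)\colon c\to d$ for $c\subseteq d$ (inclusions), closed under identities and composition, such that $f=hg$ with $f,g$ inclusions forces $h$ to be an inclusion. A retraction is a morphism $e\colon c\to c'$ with $c'\subseteq c$ and $j(c',c)e=1$. A normal cone $\gamma$ with vertex $c_\gamma$ is a family $\gamma(c)\colon c\to c_\gamma$ over all objects $c$ with $j(c,c')\gamma(c')=\gamma(c)$ for $c\subseteq c'$, at least one $\gamma(c)$ being an isomorphism. $\mathcal C$ is normal if every morphism factors as $f=evj$ (retraction, isomorphism, inclusion; $f^\circ=ev$ is then uniquely determined by $f$), every inclusion splits, and every object $c$ is the vertex of a normal cone $\gamma$ with $\gamma(c)=1_c$. The normal cones form $T\mathcal C$ with $\gamma\cdot\sigma=\gamma*(\sigma(c_\gamma))^\circ$, where $(\gamma*q)(c)=\gamma(c)q$. For $\varepsilon\in T\mathcal C$, $H(\varepsilon;-)\colon\mathcal C\to\mathbf{Set}$ is the functor $c\mapsto\{\varepsilon*f^\circ: f\in\mathcal C(c_\varepsilon,c)\}$,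 with $g$ acting by $\varepsilon*f^\circ\mapsto\varepsilon*(fg)^\circ$. The normal dual $N^*\mathcal C$ has as objects the $H(\varepsilon;-)$ with $\varepsilon$ idempotent and as morphisms the natural transformations; its inclusions are those with all components set inclusions. $MH(\varepsilon;-)=\{c:\varepsilon(c)\text{ is an isomorphism}\}$. **Cross-connections.** Let $\mathcal C,\mathcal D$ be normal categories. A cross-connection from $\mathcal D$ to $\mathcal C$ is a functor $\Gamma\colon\mathcal D\to N^*\mathcal C$ that preserves inclusions, is fully faithful, maps each principal ideal $\langle d\rangle$ (the full subcategory of subobjects of $d$) isomorphically onto $\langle\Gamma(d)\rangle$, and is such that every $c$ lies in some $M\Gamma(d)$. Put $\Gamma(c,d)=\Gamma(d)(c)$; for $\Delta\colon\mathcal C\to N^*\mathcal D$ put $\Delta(c,d)=\Delta(c)(d)$; these are bifunctors $\mathcal C\times\mathcal D\to\mathbf{Set}$. A cross-connection $\Delta$ from $\mathcal C$ to $\mathcal D$ is dual to $\Gamma$ with duality $\chi$ if $c\in M\Gamma(d)\iff d\in M\Delta(c)$, and $\chi\colon\Gamma(-,-)\to\Delta(-,-)$ is a natural isomorphism which, whenever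 $c\in M\Gamma(d)$, sends the idempotent cone with vertex $c$ and $H$-functor $\Gamma(d)$ to the idempotent cone with vertex $d$ and $H$-functor $\Delta(c)$. Then $\gamma$ is linked to $\delta$ if $\gamma\in\Gamma(c,d)$ and $\delta=\chi(c,d)(\gamma)$ for some $(c,d)$, and $\tilde S\Gamma$ is the set of linked pairs in $U\Gamma\times U\Delta$, where $U\Gamma=\bigcup\Gamma(c,d)$ and $U\Delta=\bigcup\Delta(c,d)$, with $(\gamma,\delta)\circ(\gamma',\delta')=(\gamma\cdot\gamma',\delta'\cdot\delta)$. **The categories of a set.** Let $X$ be a set with at least two elements. $Sing(X)$ is the semigroup of all transformations of $X$ that are neither injective nor surjective. $\mathscr P(X)$ is the category of non-empty proper subsets of $X$ and all maps between them, with the usual inclusions. $\Pi(X)$ has an object $\bar\pi$ (the set of all functions $\pi\to X$) for every partition $\pi$ of $X$ other than the one into singletons; its morphisms $\bar\pi_1\to\bar\pi_2$ are the maps $\eta^*\colon\alpha\mapsto\eta\alpha$ for $\eta\colon\pi_2\to\pi_1$; $\bar\pi_1\subseteq\bar\pi_2$ iff $\pi_2$ refines $\pi_1$, the inclusion being $\nu^*$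 with $\nu$ sending a block to the block containing it. Both are normal categories. For $a\in Sing(X)$ let $\pi_a$ be the partition of $X$ into the fibres of $a$; let $\rho^a$ be the normal cone in $\mathscr P(X)$ with vertex $\operatorname{Im}a$ whose components are the restrictions of $a$, and $\sigma^a$ the normal cone in $\Pi(X)$ with vertex $\bar\pi_a$ whose component at $\bar\pi$ is given by $[x]_{\pi_a}\mapsto[xa]_\pi$. For a permutation $\theta$ of $X$, $\Gamma_\theta\colon\Pi(X)\to N^*\mathscr P(X)$ is the functor $\bar\pi\mapsto\overline{\theta^{-1}(\pi)}$, $\eta^*\mapsto(\theta\eta\theta^{-1})^*$ of $\Pi(X)$ followed by the functor $\Pi(X)\to N^*\mathscr P(X)$ that sends $\bar\pi$ to $H(\rho^e;-)$, for $e$ an idempotent with $\pi_e=\pi$, and $\eta^*$, for $\eta\colon\pi_f\to\pi_e$, to $\rho^a\mapsto\rho^{fwa}$, where $w\colon\operatorname{Im}f\to\operatorname{Im}e$ is the map corresponding to $\eta$. **Theorem.** Let $X$ be a set with at least two elements and $\theta$ a permutation of $X$. 1. If $X$ is finite, $Sing(X)$ is the set of all non-invertible transformations of $X$. 2. $\Gamma_\theta$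 is a cross-connection from $\Pi(X)$ to $\mathscr P(X)$, and it has a dual cross-connection with a duality. 3. For every dual $\Delta$ of $\Gamma_\theta$ with duality $\chi$, the linked pairs are exactly the pairs $(\rho^a,\sigma^{\theta^{-1}a\theta})$, $a\in Sing(X)$; they are closed under $\circ$, and $a\mapsto(\rho^a,\sigma^{\theta^{-1}a\theta})$ is an isomorphism of $Sing(X)$ onto the cross-connection semigroup $\tilde S\Gamma_\theta$. -/

import Mathlib

open CategoryTheory

universe u

noncomputable section

namespace CrossConn

/-! ### Categories with subobjects and normal categories

All categories are small.  Composition `f ≫ g` is read from left to right. -/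

/-- A category with subobjects: the subcategory of inclusions is a partial order on the objects
(it contains all the objects and has at most one morphism between two of them), every inclusion is
a monomorphism, and if `f = h ≫ g` with `f` and `g` inclusions, then `h` is an inclusion. -/
class SubobjCat (C : Type u) [SmallCategory C] extends PartialOrder C where
  /-- the inclusion `j(c, d)` -/
  incl : ∀ {c d : C}, c ≤ d → (c ⟶ d)
  incl_refl : ∀ c : C, incl (le_refl c) = 𝟙 c
  incl_trans : ∀ {c d e : C} (h : c ≤ d) (k : d ≤ e), incl h ≫ incl k = incl (h.trans k)
  incl_mono : ∀ {c d : C} (h : c ≤ d), Mono (incl h)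
  incl_cancel : ∀ {c d e : C} (f : c ≤ e) (g : d ≤ e) (h : c ⟶ d),
    incl f = h ≫ incl g → ∃ k : c ≤ d, h = incl k

section General

variable {C : Type u} [SmallCategory C] [SubobjCat C]

/-- `e : c ⟶ c'` is a retraction: `c' ⊆ c` and `j(c', c) e = 1`. -/
def IsRetraction {c c' : C} (e : c ⟶ c') : Prop :=
  ∃ h : c' ≤ c, SubobjCat.incl h ≫ e = 𝟙 c'

variable (C) in
/-- A normal cone: a cone from the base `vC` to a vertex, at least one component of which is an
isomorphism. -/
structure NormalCone where
  vertex : C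
  app : ∀ c : C, c ⟶ vertex
  compat : ∀ {c c' : C} (h : c ≤ c'), SubobjCat.incl h ≫ app c' = app c
  normal : ∃ c : C, IsIso (app c)

variable (C) in
/-- A normal category: every morphism has a normal factorization, every inclusion splits, and each
object `c` is the vertex of a normal cone whose component at `c` is the identity. -/
class NormalCat : Prop where
  exists_fact : ∀ {c d : C} (f : c ⟶ d), ∃ (c' d' : C) (e : c ⟶ c') (v : c' ⟶ d') (h : d' ≤ d),
    IsRetraction e ∧ IsIso v ∧ f = (e ≫ v) ≫ SubobjCat.incl h
  incl_split : ∀ {c d : C} (h : c ≤ d), ∃ e : d ⟶ c, SubobjCat.incl h ≫ e = 𝟙 c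
  exists_cone : ∀ c : C, ∃ (γ : NormalCone C) (h : γ.vertex = c), γ.app c = eqToHom h.symm

theorem eqToHom_incl {c c' d : C} (e : c = c') (h : c' ≤ d) (h' : c ≤ d) :
    eqToHom e ≫ SubobjCat.incl h = SubobjCat.incl h' := by
  subst e
  simp

end General

section Normal

variable {C : Type u} [SmallCategory C] [SubobjCat C] [NormalCat C]

theorem exists_epi_part {c d : C} (f : c ⟶ d) : ∃ (d' : C) (q : c ⟶ d') (h : d' ≤ d),
    (∃ (c' : C) (e : c ⟶ c') (v : c' ⟶ d'), IsRetraction e ∧ IsIso v ∧ q = e ≫ v) ∧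
      f = q ≫ SubobjCat.incl h := by
  obtain ⟨c', d', e, v, h, he, hv, hf⟩ := NormalCat.exists_fact f
  exact ⟨d', e ≫ v, h, ⟨c', e, v, he, hv, rfl⟩, hf⟩

/-- The codomain of the epimorphic component `f°` of `f`. -/
def im {c d : C} (f : c ⟶ d) : C := (exists_epi_part f).choose

/-- The epimorphic component `f° = e v` of `f`, where `f = e v j` is a normal factorization;
see `epiPart_unique` for its independence of the factorization. -/
def epiPart {c d : C} (f : c ⟶ d) : c ⟶ im f := (exists_epi_part f).choose_spec.choose

theorem im_le {c d : C} (f : c ⟶ d) : im f ≤ d :=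
  (exists_epi_part f).choose_spec.choose_spec.choose

theorem epiPart_spec {c d : C} (f : c ⟶ d) :
    ∃ (c' : C) (e : c ⟶ c') (v : c' ⟶ im f), IsRetraction e ∧ IsIso v ∧ epiPart f = e ≫ v :=
  (exists_epi_part f).choose_spec.choose_spec.choose_spec.1

theorem epiPart_incl {c d : C} (f : c ⟶ d) : epiPart f ≫ SubobjCat.incl (im_le f) = f :=
  (exists_epi_part f).choose_spec.choose_spec.choose_spec.2.symm

theorem epiPart_section {c d : C} (f : c ⟶ d) : ∃ s : im f ⟶ c, s ≫ epiPart f = 𝟙 _ := by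
  obtain ⟨c', e, v, ⟨h, he⟩, hv, hq⟩ := epiPart_spec f
  refine ⟨inv v ≫ SubobjCat.incl h, ?_⟩
  rw [hq, Category.assoc, ← Category.assoc _ e, he, Category.id_comp, IsIso.inv_hom_id]

instance {c d : C} (f : c ⟶ d) : Epi (epiPart f) := by
  obtain ⟨s, hs⟩ := epiPart_section f
  constructor
  intro Z g h hgh
  have := congrArg (fun k => s ≫ k) hgh
  simpa only [← Category.assoc, hs, Category.id_comp] using this

theorem epiPart_unique {c d d' : C} (f : c ⟶ d) (q : c ⟶ d') (s : d' ⟶ c) (hs : s ≫ q = 𝟙 _)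
    (h : d' ≤ d) (hf : q ≫ SubobjCat.incl h = f) :
    ∃ e : d' = im f, q ≫ eqToHom e = epiPart f := by
  obtain ⟨s', hs'⟩ := epiPart_section f
  have hq := epiPart_incl f
  have h1 : SubobjCat.incl h = (s ≫ epiPart f) ≫ SubobjCat.incl (im_le f) := by
    rw [Category.assoc, hq, ← hf, ← Category.assoc, hs, Category.id_comp]
  have h2 : SubobjCat.incl (im_le f) = (s' ≫ q) ≫ SubobjCat.incl h := by
    calc SubobjCat.incl (im_le f) = s' ≫ epiPart f ≫ SubobjCat.incl (im_le f) := by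
          rw [← Category.assoc, hs', Category.id_comp]
      _ = (s' ≫ q) ≫ SubobjCat.incl h := by rw [hq, Category.assoc, hf]
  obtain ⟨k1, -⟩ := SubobjCat.incl_cancel _ _ _ h1
  obtain ⟨k2, -⟩ := SubobjCat.incl_cancel _ _ _ h2
  have e : d' = im f := le_antisymm k1 k2
  refine ⟨e, ?_⟩
  have := SubobjCat.incl_mono (im_le f)
  rw [← cancel_mono (SubobjCat.incl (im_le f)), hq, Category.assoc, eqToHom_incl e _ h, hf]

namespace NormalCone

theorem exists_isIso_star (γ : NormalCone C) {d : C} (q : γ.vertex ⟶ d) [Epi q] :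
    ∃ c, IsIso (γ.app c ≫ q) := by
  obtain ⟨c1, d1, e, v, h, ⟨h1, he⟩, hv, hq⟩ := NormalCat.exists_fact q
  -- the inclusion in the factorization of an epimorphism is an isomorphism
  have hj : IsIso (SubobjCat.incl h) := by
    obtain ⟨r, hr⟩ := NormalCat.incl_split h
    have hm := SubobjCat.incl_mono h
    have : Epi (SubobjCat.incl h) := by
      have : Epi ((e ≫ v) ≫ SubobjCat.incl h) := hq ▸ inferInstance
      exact epi_of_epi (e ≫ v) _
    refine ⟨r, hr, ?_⟩
    rw [← cancel_epi (SubobjCat.incl h), ← Category.assoc, hr, Category.id_comp, Category.comp_id]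
  obtain ⟨c, hc⟩ := γ.normal
  obtain ⟨c2, p, hle, hf, hp⟩ : ∃ (c2 : C) (p : c1 ⟶ c2) (hle : c2 ≤ c),
      p ≫ SubobjCat.incl hle = SubobjCat.incl h1 ≫ inv (γ.app c) ∧ Epi p :=
    ⟨_, _, im_le _, epiPart_incl (SubobjCat.incl h1 ≫ inv (γ.app c)), inferInstance⟩
  refine ⟨c2, ?_⟩
  have h3 : p ≫ γ.app c2 ≫ e = 𝟙 _ := by
    rw [← γ.compat hle, ← Category.assoc, ← Category.assoc, hf, Category.assoc _ _ (γ.app c),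
      IsIso.inv_hom_id, Category.comp_id, he]
  have h4 : IsIso (γ.app c2 ≫ e) := by
    refine ⟨p, ?_, h3⟩
    rw [← cancel_epi p, ← Category.assoc, h3, Category.id_comp, Category.comp_id]
  have : γ.app c2 ≫ q = (γ.app c2 ≫ e) ≫ v ≫ SubobjCat.incl h := by
    rw [hq]; simp only [Category.assoc]
  rw [this]
  infer_instance

/-- The normal cone `γ ∗ q : c ↦ γ(c) q` for an epimorphism `q` from the vertex of `γ`. -/
def star (γ : NormalCone C) {d : C} (q : γ.vertex ⟶ d) [Epi q] : NormalCone C where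
  vertex := d
  app c := γ.app c ≫ q
  compat h := by rw [← Category.assoc, γ.compat]
  normal := γ.exists_isIso_star q

/-- The semigroup operation of `TC`: `γ · σ = γ ∗ (σ(c_γ))°`. -/
instance : Mul (NormalCone C) := ⟨fun γ σ => γ.star (epiPart (σ.app γ.vertex))⟩

theorem star_congr (γ : NormalCone C) {d d' : C} (q : γ.vertex ⟶ d) [Epi q]
    (q' : γ.vertex ⟶ d') [Epi q'] (e : d = d') (h : q ≫ eqToHom e = q') :
    γ.star q = γ.star q' := by
  subst e
  simp only [eqToHom_refl, Category.comp_id] at h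
  subst h
  rfl

theorem star_inj (γ : NormalCone C) {d d' : C} (q : γ.vertex ⟶ d) [Epi q]
    (q' : γ.vertex ⟶ d') [Epi q'] (h : γ.star q = γ.star q') :
    ∃ e : d = d', q ≫ eqToHom e = q' := by
  simp only [star, NormalCone.mk.injEq] at h
  obtain ⟨e, h⟩ := h
  subst e
  refine ⟨rfl, ?_⟩
  obtain ⟨c, hc⟩ := γ.normal
  have := congrFun (eq_of_heq h) c
  rw [cancel_epi] at this
  simpa using this

theorem star_epiPart_inj (γ : NormalCone C) {d : C} {f g : γ.vertex ⟶ d}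
    (h : γ.star (epiPart f) = γ.star (epiPart g)) : f = g := by
  obtain ⟨e, h⟩ := star_inj _ _ _ h
  calc f = epiPart f ≫ SubobjCat.incl (im_le f) := (epiPart_incl f).symm
    _ = epiPart g ≫ SubobjCat.incl (im_le g) := by
      rw [← h, Category.assoc, eqToHom_incl e _ (im_le f)]
    _ = g := epiPart_incl g

theorem isIdempotentElem_of_app_vertex (γ : NormalCone C) (h : γ.app γ.vertex = 𝟙 _) :
    IsIdempotentElem γ := by
  obtain ⟨e, he⟩ := epiPart_unique (γ.app γ.vertex) (𝟙 _) (𝟙 _) (by simp) le_rfl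
    (by rw [SubobjCat.incl_refl, h]; simp)
  have h1 : γ.star (𝟙 _) = γ := by
    cases γ; simp [star]
  have h2 := star_congr γ _ _ e he
  exact h2.symm.trans h1

/-- The set `H(ε; c) = {ε ∗ f° : f ∈ C(c_ε, c)}`. -/
def hSet (ε : NormalCone C) (c : C) : Set (NormalCone C) :=
  {τ | ∃ f : ε.vertex ⟶ c, τ = ε.star (epiPart f)}

/-- The action of `g : c ⟶ d` on cones with vertex contained in `c`; on the elements of `H(ε; c)`
it is `ε ∗ f° ↦ ε ∗ (f g)°`, see `push_star`. -/
def push (τ : NormalCone C) {c d : C} (h : τ.vertex ≤ c) (g : c ⟶ d) : NormalCone C :=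
  τ.star (epiPart (SubobjCat.incl h ≫ g))

theorem push_star (ε : NormalCone C) {c d : C} (f : ε.vertex ⟶ c) (g : c ⟶ d) :
    (ε.star (epiPart f)).push (im_le f) g = ε.star (epiPart (f ≫ g)) := by
  obtain ⟨s, hs⟩ := epiPart_section f
  obtain ⟨t, ht⟩ := epiPart_section (SubobjCat.incl (im_le f) ≫ g)
  obtain ⟨e, he⟩ := epiPart_unique (f ≫ g)
    (epiPart f ≫ epiPart (SubobjCat.incl (im_le f) ≫ g)) (t ≫ s)
    (by rw [Category.assoc, ← Category.assoc s, hs, Category.id_comp, ht]) (im_le _)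
    (by rw [Category.assoc, epiPart_incl, ← Category.assoc, epiPart_incl])
  rw [← star_congr ε _ _ e he]
  simp [push, star]

end NormalCone

/-! ### The normal dual -/

variable (C) in
/-- The objects of the normal dual `N*C`: the `H`-functors `H(ε; -)` for idempotent normal cones
`ε`.  Such a functor is determined by the sets `H(ε; c)`, since its action on morphisms is the
one of `NormalCone.push`. -/
@[ext]
structure NDual where
  toSet : C → Set (NormalCone C)
  exists_idem : ∃ ε : NormalCone C, IsIdempotentElem ε ∧ toSet = ε.hSet

namespace NDual

/-- The object `H(ε; -)` of the normal dual. -/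
def of (ε : NormalCone C) (h : IsIdempotentElem ε) : NDual C := ⟨ε.hSet, ε, h, rfl⟩

theorem vertex_le (F : NDual C) {c : C} {τ : NormalCone C} (h : τ ∈ F.toSet c) :
    τ.vertex ≤ c := by
  obtain ⟨ε, -, hF⟩ := F.exists_idem
  rw [hF] at h
  obtain ⟨f, rfl⟩ := h
  exact im_le f

theorem push_mem (F : NDual C) {c d : C} {τ : NormalCone C} (h : τ ∈ F.toSet c) (g : c ⟶ d) :
    τ.push (F.vertex_le h) g ∈ F.toSet d := by
  obtain ⟨ε, -, hF⟩ := F.exists_idem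
  have h' := h
  rw [hF] at h'
  obtain ⟨f, rfl⟩ := h'
  rw [hF]
  exact ⟨f ≫ g, NormalCone.push_star ε f g⟩

/-- The underlying set-valued functor of an object of the normal dual. -/
def functor (F : NDual C) : C ⥤ Type u where
  obj c := F.toSet c
  map g := TypeCat.ofHom fun τ => ⟨τ.1.push (F.vertex_le τ.2) g, F.push_mem τ.2 g⟩
  map_id c := by
    ext ⟨τ, hτ⟩
    obtain ⟨ε, -, hF⟩ := F.exists_idem
    have h' := hτ
    rw [hF] at h'
    obtain ⟨f, rfl⟩ := h'
    refine (NormalCone.push_star ε f (𝟙 c)).trans ?_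
    rw [Category.comp_id]
    rfl
  map_comp g k := by
    ext ⟨τ, hτ⟩
    obtain ⟨ε, -, hF⟩ := F.exists_idem
    have h' := hτ
    rw [hF] at h'
    obtain ⟨f, rfl⟩ := h'
    refine (NormalCone.push_star ε f (g ≫ k)).trans ?_
    have h1 := NormalCone.push_star ε f g
    have h2 := NormalCone.push_star ε (f ≫ g) k
    rw [← Category.assoc, ← h2]
    change _ = NormalCone.push (NormalCone.push _ _ _) _ _
    congr 1
    exact h1.symm

/-- The morphisms of `N*C` are all the natural transformations. -/
instance : SmallCategory (NDual C) :=
  inferInstanceAs (Category (InducedCategory (C ⥤ Type u) NDual.functor))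

/-- The component at `c` of a morphism of `N*C`, as a map from `F(c)` to `G(c)`. -/
def app {F G : NDual C} (σ : F ⟶ G) (c : C) : F.toSet c → G.toSet c :=
  fun τ => (ConcreteCategory.hom (σ.hom.app c)) τ

variable (C) in
/-- The full embedding of `N*C` into the category of functors from `C` to sets. -/
def ι : NDual C ⥤ (C ⥤ Type u) := inducedFunctor NDual.functor

/-- The `M`-set of an `H`-functor `H(ε; -)`: the objects `c` for which `ε(c)` is an
isomorphism. -/
def mSet (F : NDual C) : Set C :=
  {c | ∃ ε : NormalCone C, IsIdempotentElem ε ∧ F.toSet = ε.hSet ∧ IsIso (ε.app c)}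

/-- The inclusions of the normal dual are the natural transformations all of whose components are
set inclusions. -/
instance : SubobjCat (NDual C) where
  le F G := ∀ c, F.toSet c ⊆ G.toSet c
  le_refl F c := Set.Subset.refl _
  le_trans F G H h k c := (h c).trans (k c)
  le_antisymm F G h k := NDual.ext (funext fun c => (h c).antisymm (k c))
  incl {F G} h := InducedCategory.homMk
    { app := fun c => TypeCat.ofHom fun τ => ⟨τ.1, h c τ.2⟩
      naturality := fun c d g => rfl }
  incl_refl F := rfl
  incl_trans h k := rfl
  incl_mono {F G} h := by
    constructor
    intro H a b hab
    apply InducedCategory.hom_ext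
    ext c τ
    apply Subtype.ext
    have h1 := congrArg (fun k => (app k c τ).1) hab
    exact h1
  incl_cancel {F G H} f g h hh := by
    have key : ∀ c (τ : F.toSet c), (app h c τ).1 = τ.1 := by
      intro c τ
      have h1 := congrArg (fun k => (app k c τ).1) hh
      exact h1.symm
    refine ⟨fun c τ hτ => ?_, ?_⟩
    · have h1 := (app h c ⟨τ, hτ⟩).2
      rwa [key c ⟨τ, hτ⟩] at h1
    · apply InducedCategory.hom_ext
      ext c τ
      apply Subtype.ext
      exact key c τ

/-- The natural transformation `H(ε; -) ⟶ H(ε'; -)`, `ε ∗ f° ↦ ε' ∗ (w f)°`, defined by a morphism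
`w : c_ε' ⟶ c_ε`; see `ofHat_apply`. -/
def ofHat (ε ε' : NormalCone C) (h : IsIdempotentElem ε) (h' : IsIdempotentElem ε')
    (w : ε'.vertex ⟶ ε.vertex) : of ε h ⟶ of ε' h' := InducedCategory.homMk
  { app := fun c => TypeCat.ofHom fun (τ : ε.hSet c) =>
      (⟨ε'.star (epiPart (w ≫ τ.2.choose)), _, rfl⟩ : ε'.hSet c)
    naturality := by
      intro c d g
      ext ⟨τ, hτ⟩
      apply Subtype.ext
      have h1 : τ = ε.star (epiPart hτ.choose) := hτ.choose_spec
      have h2 := ((of ε h).push_mem hτ g)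
      have h3 : h2.choose = hτ.choose ≫ g := by
        apply ε.star_epiPart_inj
        rw [← h2.choose_spec, ← NormalCone.push_star]
        congr 1
      change ε'.star (epiPart (w ≫ h2.choose)) =
        NormalCone.push (ε'.star (epiPart (w ≫ hτ.choose))) _ g
      rw [NormalCone.push_star ε' (w ≫ hτ.choose) g, h3, Category.assoc] }

theorem ofHat_apply (ε ε' : NormalCone C) (h : IsIdempotentElem ε) (h' : IsIdempotentElem ε')
    (w : ε'.vertex ⟶ ε.vertex) {c : C} (f : ε.vertex ⟶ c) :
    (app (ofHat ε ε' h h' w) c ⟨ε.star (epiPart f), f, rfl⟩).1 =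
      ε'.star (epiPart (w ≫ f)) := by
  have hτ : ε.star (epiPart f) ∈ ε.hSet c := ⟨f, rfl⟩
  have h1 : hτ.choose = f := ε.star_epiPart_inj hτ.choose_spec.symm
  change ε'.star (epiPart (w ≫ hτ.choose)) = _
  rw [h1]

theorem hom_ext' {F G : NDual C} {σ σ' : F ⟶ G} (h : ∀ c τ, (app σ c τ).1 = (app σ' c τ).1) :
    σ = σ' := by
  apply InducedCategory.hom_ext
  ext c τ
  exact Subtype.ext (h c τ)

theorem ofHat_id (ε : NormalCone C) (h : IsIdempotentElem ε) :
    ofHat ε ε h h (𝟙 _) = 𝟙 _ := by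
  apply hom_ext'
  rintro c ⟨τ, f, rfl⟩
  rw [ofHat_apply, Category.id_comp]
  rfl

theorem ofHat_comp (ε ε' ε'' : NormalCone C) (h : IsIdempotentElem ε) (h' : IsIdempotentElem ε')
    (h'' : IsIdempotentElem ε'') (w : ε'.vertex ⟶ ε.vertex) (w' : ε''.vertex ⟶ ε'.vertex) :
    ofHat ε ε'' h h'' (w' ≫ w) = ofHat ε ε' h h' w ≫ ofHat ε' ε'' h' h'' w' := by
  apply hom_ext'
  rintro c ⟨τ, f, rfl⟩
  have h1 : app (ofHat ε ε' h h' w) c ⟨ε.star (epiPart f), f, rfl⟩ =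
      ⟨ε'.star (epiPart (w ≫ f)), w ≫ f, rfl⟩ := Subtype.ext (ofHat_apply ε ε' h h' w f)
  change _ = (app (ofHat ε' ε'' h' h'' w') c
    (app (ofHat ε ε' h h' w) c ⟨ε.star (epiPart f), f, rfl⟩)).1
  rw [h1, ofHat_apply, ofHat_apply, Category.assoc]

end NDual

end Normal

/-! ### Cross-connections -/

/-- A local isomorphism: an inclusion preserving, fully faithful functor whose restriction to each
principal ideal `⟨c⟩` (the full subcategory of the subobjects of `c`) is an isomorphism onto the
principal ideal `⟨F(c)⟩`.  As `F` is fully faithful, the last condition says that `F` maps the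
objects of the first ideal bijectively onto those of the second. -/
structure IsLocalIso {C D : Type u} [SmallCategory C] [SubobjCat C] [SmallCategory D] [SubobjCat D]
    (F : C ⥤ D) : Prop where
  map_incl : ∀ {c c' : C} (h : c ≤ c'), ∃ k : F.obj c ≤ F.obj c',
    F.map (SubobjCat.incl h) = SubobjCat.incl k
  full : F.Full
  faithful : F.Faithful
  ideal : ∀ c : C, Set.BijOn F.obj (Set.Iic c) (Set.Iic (F.obj c))

section Cross

variable {C D : Type u} [SmallCategory C] [SubobjCat C] [NormalCat C]
  [SmallCategory D] [SubobjCat D] [NormalCat D]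

/-- `(D, C; Γ)` is a cross-connection. -/
structure IsCrossConnection (Γ : D ⥤ NDual C) : Prop where
  localIso : IsLocalIso Γ
  total : ∀ c : C, ∃ d : D, c ∈ (Γ.obj d).mSet

/-- The bifunctor `Γ(-,-) : C × D ⥤ Set` of `Γ : D ⥤ N*C`, with `Γ(c, d) = Γ(d)(c)`. -/
def bifunctor (Γ : D ⥤ NDual C) : C × D ⥤ Type u :=
  Functor.uncurry.obj (Γ ⋙ NDual.ι C).flip

/-- The bifunctor `Δ(-,-) : C × D ⥤ Set` of `Δ : C ⥤ N*D`, with `Δ(c, d) = Δ(c)(d)`. -/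
def dualBifunctor (Δ : C ⥤ NDual D) : C × D ⥤ Type u :=
  Functor.uncurry.obj (Δ ⋙ NDual.ι D)

/-- The component at `(c, d)` of a natural isomorphism between the two bifunctors, as a map from
a set of normal cones in `C` to a set of normal cones in `D`. -/
def dualityMap {Γ : D ⥤ NDual C} {Δ : C ⥤ NDual D} (χ : bifunctor Γ ≅ dualBifunctor Δ)
    (c : C) (d : D) : (Γ.obj d).toSet c → (Δ.obj c).toSet d :=
  fun γ => (ConcreteCategory.hom (χ.hom.app (c, d))) γ

/-- `Δ` is the dual cross-connection of `Γ`, with duality `χ`: `Δ` is a cross-connection from `C`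
to `D`; `c` lies in the `M`-set of `Γ(d)` if and only if `d` lies in the `M`-set of `Δ(c)`; and
`χ` is a natural isomorphism between the bifunctors which takes the idempotent cone `γ(c, d)` with
vertex `c` and `H(γ(c, d); -) = Γ(d)` to the idempotent cone `δ(c, d)` with vertex `d` and
`H(δ(c, d); -) = Δ(c)`, whenever these exist, that is, whenever `c` lies in the `M`-set
of `Γ(d)`. -/
structure IsDual (Γ : D ⥤ NDual C) (Δ : C ⥤ NDual D)
    (χ : bifunctor Γ ≅ dualBifunctor Δ) : Prop where
  cross : IsCrossConnection Δ
  mem_mSet : ∀ (c : C) (d : D), c ∈ (Γ.obj d).mSet ↔ d ∈ (Δ.obj c).mSet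
  map_idem : ∀ (c : C) (d : D) (γ : (Γ.obj d).toSet c) (δ : (Δ.obj c).toSet d),
    IsIdempotentElem γ.1 → γ.1.vertex = c → (Γ.obj d).toSet = γ.1.hSet →
    IsIdempotentElem δ.1 → δ.1.vertex = d → (Δ.obj c).toSet = δ.1.hSet →
    dualityMap χ c d γ = δ

/-- `UΓ`, the union of the sets `Γ(c, d)`; applied to `Δ`, the union of the sets `Δ(c, d)`. -/
def unionSet (Γ : D ⥤ NDual C) : Set (NormalCone C) := ⋃ (c : C) (d : D), (Γ.obj d).toSet c

/-- `γ` is linked to `δ`: there are `c`, `d` with `γ ∈ Γ(c, d)` and `δ = χ(c, d)(γ)`. -/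
def Linked {Γ : D ⥤ NDual C} {Δ : C ⥤ NDual D} (χ : bifunctor Γ ≅ dualBifunctor Δ)
    (γ : NormalCone C) (δ : NormalCone D) : Prop :=
  ∃ (c : C) (d : D) (h : γ ∈ (Γ.obj d).toSet c), δ = (dualityMap χ c d ⟨γ, h⟩).1

/-- The underlying set of the cross-connection semigroup: the linked pairs.  The operation
`(γ, δ) ∘ (γ', δ') = (γ γ', δ' δ)` is the one of the product of `TC` and the opposite of `TD`. -/
def linkedPairs {Γ : D ⥤ NDual C} {Δ : C ⥤ NDual D} (χ : bifunctor Γ ≅ dualBifunctor Δ) :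
    Set (NormalCone C × (NormalCone D)ᵐᵒᵖ) :=
  {p | p.1 ∈ unionSet Γ ∧ p.2.unop ∈ unionSet Δ ∧ Linked χ p.1 p.2.unop}

end Cross

/-! ### Singular transformations, the powerset category, the category of partitions -/

/-- The transformations of `X` that are neither injective nor surjective (for a finite set, these
are the non-invertible transformations). -/
@[ext]
structure Sing (X : Type u) where
  toFun : X → X
  not_injective : ¬ Function.Injective toFun
  not_surjective : ¬ Function.Surjective toFun

namespace Sing

variable {X : Type u}

/-- Composition of transformations from left to right. -/
instance : Mul (Sing X) := ⟨fun a b =>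
  { toFun := fun x => b.toFun (a.toFun x)
    not_injective := fun h => a.not_injective (Function.Injective.of_comp (f := b.toFun) h)
    not_surjective := fun h => b.not_surjective (Function.Surjective.of_comp (g := a.toFun) h) }⟩

/-- The transformation `θ⁻¹ a θ` (composed from left to right). -/
def conj (θ : Equiv.Perm X) (a : Sing X) : Sing X where
  toFun := fun x => θ (a.toFun (θ.symm x))
  not_injective := fun h => a.not_injective fun x y hxy => θ.injective
    (h (a₁ := θ x) (a₂ := θ y) (by simp [hxy]))
  not_surjective := fun h => a.not_surjective fun y => by
    obtain ⟨x, hx⟩ := h (θ y)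
    exact ⟨θ.symm x, θ.injective hx⟩

end Sing

/-- The objects of the powerset category `𝒫(X)`: the non-empty proper subsets of `X`. -/
@[ext]
structure PowObj (X : Type u) where
  carrier : Set X
  nonempty : carrier.Nonempty
  ne_univ : carrier ≠ Set.univ

namespace PowObj

variable {X : Type u}

/-- The morphisms of the powerset category are all the maps. -/
instance : SmallCategory (PowObj X) where
  Hom A B := A.carrier → B.carrier
  id A := fun x => x
  comp f g := fun x => g (f x)

instance : SubobjCat (PowObj X) where
  le A B := A.carrier ⊆ B.carrier
  le_refl A := Set.Subset.refl _
  le_trans A B D h k := Set.Subset.trans h k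
  le_antisymm A B h k := PowObj.ext (Set.Subset.antisymm h k)
  incl h := fun x => ⟨x.1, h x.2⟩
  incl_refl A := rfl
  incl_trans h k := rfl
  incl_mono {A B} h := by
    constructor
    intro Z f g hfg
    funext x
    apply Subtype.ext
    have h1 := congrFun hfg x
    exact congrArg (Subtype.val : B.carrier → X) h1
  incl_cancel f g h hh := by
    have key : ∀ x, (h x).1 = x.1 := fun x => (congrArg Subtype.val (congrFun hh x)).symm
    refine ⟨fun x hx => ?_, ?_⟩
    · have h1 := (h ⟨x, hx⟩).2
      rwa [key ⟨x, hx⟩] at h1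
    · funext x
      exact Subtype.ext (key x)

theorem isIso_of_bijective {A B : PowObj X} (f : A ⟶ B)
    (hf : Function.Bijective (f : A.carrier → B.carrier)) : IsIso f :=
  ⟨(Equiv.ofBijective _ hf).symm, funext fun x => (Equiv.ofBijective _ hf).symm_apply_apply x,
    funext fun x => (Equiv.ofBijective _ hf).apply_symm_apply x⟩

theorem ne_univ_of_subset {A : PowObj X} {B : Set X} (h : B ⊆ A.carrier) : B ≠ Set.univ :=
  fun hB => A.ne_univ (Set.univ_subset_iff.1 (hB ▸ h))

instance : NormalCat (PowObj X) where
  exists_fact {A B} f := by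
    have : Nonempty A.carrier := A.nonempty.to_subtype
    let f' : A.carrier → B.carrier := f
    let g : A.carrier → A.carrier := fun x => Function.invFun f' (f' x)
    have hg : ∀ x, f' (g x) = f' x := fun x => Function.invFun_eq ⟨x, rfl⟩
    let A' : PowObj X := ⟨{y | ∃ x, (g x).1 = y},
      A.nonempty.elim fun x hx => ⟨_, ⟨x, hx⟩, rfl⟩,
      ne_univ_of_subset (A := A) (by rintro _ ⟨x, rfl⟩; exact (g x).2)⟩
    let B' : PowObj X := ⟨{y | ∃ x, (f' x).1 = y},
      A.nonempty.elim fun x hx => ⟨_, ⟨x, hx⟩, rfl⟩,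
      ne_univ_of_subset (A := B) (by rintro _ ⟨x, rfl⟩; exact (f' x).2)⟩
    have hA' : A' ≤ A := by rintro _ ⟨x, rfl⟩; exact (g x).2
    have hB' : B' ≤ B := by rintro _ ⟨x, rfl⟩; exact (f' x).2
    let e : A ⟶ A' := fun x => ⟨(g x).1, x, rfl⟩
    let v : A' ⟶ B' := fun y => ⟨(f' ⟨y.1, hA' y.2⟩).1, _, rfl⟩
    refine ⟨A', B', e, v, hB', ⟨hA', ?_⟩, isIso_of_bijective v ⟨?_, ?_⟩, ?_⟩
    · funext ⟨y, x, hx⟩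
      subst hx
      apply Subtype.ext
      change (g (g x)).1 = (g x).1
      simp only [g]
      rw [Function.invFun_eq (f := f') ⟨x, rfl⟩]
    · rintro ⟨_, x, rfl⟩ ⟨_, y, rfl⟩ h
      have h1 : f' (g x) = f' (g y) := Subtype.ext (congrArg (Subtype.val : B'.carrier → X) h)
      rw [hg, hg] at h1
      apply Subtype.ext
      change (g x).1 = (g y).1
      simp only [g, h1]
    · rintro ⟨_, x, rfl⟩
      exact ⟨⟨_, x, rfl⟩, Subtype.ext (congrArg (Subtype.val : B.carrier → X) (hg x))⟩
    · funext x
      exact Subtype.ext (congrArg (Subtype.val : B.carrier → X) (hg x).symm)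
  incl_split {A B} h := by
    classical
    obtain ⟨a, ha⟩ := A.nonempty
    refine ⟨fun x => if hx : x.1 ∈ A.carrier then ⟨x.1, hx⟩ else ⟨a, ha⟩, ?_⟩
    funext x
    exact dif_pos x.2
  exists_cone A := by
    classical
    obtain ⟨a, ha⟩ := A.nonempty
    refine ⟨{ vertex := A
              app := fun B x => if hx : x.1 ∈ A.carrier then ⟨x.1, hx⟩ else ⟨a, ha⟩
              compat := fun h => rfl
              normal := ⟨A, ?_⟩ }, rfl, ?_⟩
    · have h1 : (fun x => if hx : x.1 ∈ A.carrier then ⟨x.1, hx⟩ else ⟨a, ha⟩ : A ⟶ A) = 𝟙 A :=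
        funext fun x => dif_pos x.2
      rw [h1]
      infer_instance
    · exact funext fun x => dif_pos x.2

end PowObj

/-- The objects `π̄` of the category of partitions `Π(X)`, for the non-identity partitions `π` of
`X`, given as equivalence relations. -/
@[ext]
structure Partn (X : Type u) where
  rel : Setoid X
  ne_bot : rel ≠ ⊥

namespace Partn

variable {X : Type u}

/-- A morphism from `π̄₁` to `π̄₂` is the map `η* : α ↦ η α` from the functions `π₁ → X` to the
functions `π₂ → X` defined by a function `η : π₂ → π₁`; it is represented by `η`, which it
determines, see `star_injective`. -/
instance : SmallCategory (Partn X) where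
  Hom P Q := Quotient Q.rel → Quotient P.rel
  id P := fun x => x
  comp f g := fun x => f (g x)

/-- The map `η*` from the functions `π₁ → X` to the functions `π₂ → X`. -/
def starMap {P Q : Partn X} (η : P ⟶ Q) (α : Quotient P.rel → X) : Quotient Q.rel → X :=
  fun x => α (η x)

theorem star_injective [Nontrivial X] {P Q : Partn X} :
    Function.Injective (starMap : (P ⟶ Q) → _) := by
  classical
  intro η η' h
  funext x
  by_contra hne
  obtain ⟨y, z, hyz⟩ := exists_pair_ne X
  have := congrFun (congrFun h (fun p => if p = η x then y else z)) x
  simp [starMap, Ne.symm hne, hyz] at this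

theorem starMap_comp {P Q R : Partn X} (η : P ⟶ Q) (μ : Q ⟶ R) (α : Quotient P.rel → X) :
    starMap (η ≫ μ) α = starMap μ (starMap η α) := rfl

/-- The order is `π̄₁ ≤ π̄₂` if and only if `π₂` is finer than `π₁`, and the inclusion is `ν*` for
the map `ν` that sends a block of `π₂` to the block of `π₁` containing it. -/
instance : SubobjCat (Partn X) where
  le P Q := Q.rel ≤ P.rel
  le_refl P := le_refl P.rel
  le_trans P Q R h k := le_trans (α := Setoid X) k h
  le_antisymm P Q h k := Partn.ext (le_antisymm (α := Setoid X) k h)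
  incl {P Q} h := Quotient.map (sa := Q.rel) (sb := P.rel) (fun x => x) (fun x y hxy => h hxy)
  incl_refl P := by
    funext x
    induction x using Quotient.inductionOn
    rfl
  incl_trans h k := by
    funext x
    induction x using Quotient.inductionOn
    rfl
  incl_mono {P Q} h := by
    constructor
    intro Z f g hfg
    funext x
    induction x using Quotient.inductionOn with
    | h x => exact congrFun hfg (Quotient.mk _ x)
  incl_cancel {P Q R} f g h hh := by
    have key : ∀ x : X, h (Quotient.mk _ x) = Quotient.mk _ x := fun x =>
      (congrFun hh (Quotient.mk _ x)).symm
    refine ⟨fun x y hxy => ?_, ?_⟩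
    · apply Quotient.exact (s := P.rel)
      rw [← key x, ← key y, Quotient.sound hxy]
    · funext x
      induction x using Quotient.inductionOn with
      | h x => exact key x

theorem isIso_of_bijective {P Q : Partn X} (f : P ⟶ Q)
    (hf : Function.Bijective (f : Quotient Q.rel → Quotient P.rel)) : IsIso f :=
  ⟨(Equiv.ofBijective _ hf).symm, funext fun x => (Equiv.ofBijective _ hf).apply_symm_apply x,
    funext fun x => (Equiv.ofBijective _ hf).symm_apply_apply x⟩

theorem ne_bot_of_le {P : Partn X} {r : Setoid X} (h : P.rel ≤ r) : r ≠ ⊥ :=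
  fun hr => P.ne_bot (le_bot_iff.1 (hr ▸ h))

theorem nonempty (P : Partn X) : Nonempty X := by
  by_contra h
  rw [not_nonempty_iff] at h
  exact P.ne_bot (Setoid.ext fun x => h.elim x)

instance : NormalCat (Partn X) where
  exists_fact {P Q} f := by
    classical
    obtain ⟨x0⟩ := P.nonempty
    let η : Quotient Q.rel → Quotient P.rel := f
    let r : Quotient P.rel → Quotient P.rel := fun p =>
      if p ∈ Set.range η then p else η (Quotient.mk _ x0)
    have hr : ∀ p, r p ∈ Set.range η := by
      intro p
      by_cases h : p ∈ Set.range η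
      · simpa only [r, if_pos h] using h
      · simp only [r, if_neg h]
        exact ⟨_, rfl⟩
    have hr' : ∀ q, r (η q) = η q := fun q => if_pos ⟨q, rfl⟩
    let P' : Partn X := ⟨Setoid.ker fun x => r (Quotient.mk _ x), ne_bot_of_le (P := P)
      fun x y hxy => congrArg r (Quotient.sound hxy)⟩
    let Q' : Partn X := ⟨Setoid.ker fun x => η (Quotient.mk _ x), ne_bot_of_le (P := Q)
      fun x y hxy => congrArg η (Quotient.sound hxy)⟩
    have hP' : P' ≤ P := fun x y hxy => congrArg r (Quotient.sound hxy)
    have hQ' : Q' ≤ Q := fun x y hxy => congrArg η (Quotient.sound hxy)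
    let e : P ⟶ P' := Quotient.lift (s := P'.rel) (fun x => r (Quotient.mk _ x)) fun x y h => h
    let v : P' ⟶ Q' := Quotient.lift (s := Q'.rel)
      (fun x => Quotient.mk P'.rel (η (Quotient.mk _ x)).out) fun x y h =>
        congrArg (fun p : Quotient P.rel => Quotient.mk P'.rel p.out) h
    refine ⟨P', Q', e, v, hQ', ⟨hP', ?_⟩, isIso_of_bijective v ⟨?_, ?_⟩, ?_⟩
    · funext p
      induction p using Quotient.inductionOn with
      | h x =>
        change SubobjCat.incl hP' (r (Quotient.mk _ x)) = Quotient.mk P'.rel x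
        obtain ⟨y, hy⟩ := Quotient.exists_rep (r (Quotient.mk _ x))
        rw [← hy]
        apply Quotient.sound
        change r (Quotient.mk _ y) = r (Quotient.mk _ x)
        rw [hy]
        obtain ⟨q, hq⟩ := hr (Quotient.mk _ x)
        rw [← hq, hr']
    · intro p q
      induction p using Quotient.inductionOn with
      | h x =>
        induction q using Quotient.inductionOn with
        | h y =>
          intro h
          apply Quotient.sound
          have h1 : r (Quotient.mk _ (η (Quotient.mk _ x)).out) =
              r (Quotient.mk _ (η (Quotient.mk _ y)).out) := Quotient.exact (s := P'.rel) h
          rwa [Quotient.out_eq, Quotient.out_eq, hr', hr'] at h1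
    · intro p
      induction p using Quotient.inductionOn with
      | h z =>
        obtain ⟨q, hq⟩ := hr (Quotient.mk _ z)
        obtain ⟨x, rfl⟩ := Quotient.exists_rep q
        refine ⟨Quotient.mk _ x, Quotient.sound ?_⟩
        change r (Quotient.mk _ (η (Quotient.mk _ x)).out) = r (Quotient.mk _ z)
        rw [Quotient.out_eq, hr', hq]
    · funext q
      induction q using Quotient.inductionOn with
      | h x =>
        change η (Quotient.mk _ x) = r (Quotient.mk _ (η (Quotient.mk _ x)).out)
        rw [Quotient.out_eq, hr']
  incl_split {P Q} h := by
    refine ⟨fun p => Quotient.mk _ p.out, ?_⟩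
    funext p
    exact Quotient.out_eq p
  exists_cone P := by
    refine ⟨{ vertex := P
              app := fun Q p => Quotient.mk _ p.out
              compat := fun h => rfl
              normal := ⟨P, ?_⟩ }, rfl, ?_⟩
    · have h1 : (fun p => Quotient.mk _ p.out : P ⟶ P) = 𝟙 P := funext fun p => Quotient.out_eq p
      rw [h1]
      infer_instance
    · exact funext fun p => Quotient.out_eq p

end Partn

section Cones

variable {X : Type u}

/-- The normal cone `ρᵃ` in `𝒫(X)` of a transformation `a`: its vertex is the image of `a`, its
components are the restrictions of `a`. -/
def rhoCone (a : Sing X) : NormalCone (PowObj X) where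
  vertex := ⟨Set.range a.toFun, by
    have : Nonempty X := by
      by_contra h
      rw [not_nonempty_iff] at h
      exact a.not_injective fun x => h.elim x
    exact Set.range_nonempty _, fun h => a.not_surjective (Set.range_eq_univ.1 h)⟩
  app C := fun x => ⟨a.toFun x.1, x.1, rfl⟩
  compat h := rfl
  normal := by
    have : Nonempty X := by
      by_contra h
      rw [not_nonempty_iff] at h
      exact a.not_injective fun x => h.elim x
    have hg : ∀ x, a.toFun (Function.invFun a.toFun (a.toFun x)) = a.toFun x :=
      fun x => Function.invFun_eq ⟨x, rfl⟩
    refine ⟨⟨Set.range fun x => Function.invFun a.toFun (a.toFun x), Set.range_nonempty _, ?_⟩,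
      PowObj.isIso_of_bijective _ ⟨?_, ?_⟩⟩
    · intro h
      refine a.not_injective fun y z hyz => ?_
      obtain ⟨x, hx⟩ := Set.range_eq_univ.1 h y
      obtain ⟨w, hw⟩ := Set.range_eq_univ.1 h z
      rw [← hx, ← hw] at hyz ⊢
      simp only [hg] at hyz
      simp only [hyz]
    · rintro ⟨_, x, rfl⟩ ⟨_, y, rfl⟩ h
      have h1 := congrArg (Subtype.val : Set.range a.toFun → X) h
      apply Subtype.ext
      have h2 : a.toFun x = a.toFun y := by
        rw [← hg x, ← hg y]
        exact h1
      simp only [h2]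
    · rintro ⟨_, x, rfl⟩
      exact ⟨⟨_, x, rfl⟩, Subtype.ext (hg x)⟩

/-- The normal cone `σᵃ` in `Π(X)` of a transformation `a`: its vertex is the partition of `X`
into the fibres of `a`, its component at `ᾱ` is given by the map of blocks `[x] ↦ [x a]`. -/
def sigmaCone (a : Sing X) : NormalCone (Partn X) where
  vertex := ⟨Setoid.ker a.toFun, fun h => a.not_injective (Setoid.ker_eq_bot_iff.1 h)⟩
  app P := Quotient.lift (s := Setoid.ker a.toFun) (fun x => Quotient.mk P.rel (a.toFun x))
    fun x y h => congrArg (Quotient.mk P.rel) h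
  compat h := by
    funext p
    induction p using Quotient.inductionOn
    rfl
  normal := by
    classical
    obtain ⟨z, hz⟩ : ∃ z, z ∉ Set.range a.toFun := by
      by_contra! h
      exact a.not_surjective h
    let g : X → X := fun x => if x ∈ Set.range a.toFun then x else a.toFun x
    have hg : ∀ x, g (a.toFun x) = a.toFun x := fun x => if_pos ⟨x, rfl⟩
    have hg' : ∀ x, g x ∈ Set.range a.toFun := by
      intro x
      by_cases h : x ∈ Set.range a.toFun
      · simpa only [g, if_pos h] using h
      · simp only [g, if_neg h]
        exact ⟨_, rfl⟩
    refine ⟨⟨Setoid.ker g, fun h => ?_⟩, Partn.isIso_of_bijective _ ⟨?_, ?_⟩⟩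
    · have h1 : g (a.toFun z) = g z := by
        rw [hg]
        exact (if_neg hz).symm
      exact hz ⟨z, Setoid.ker_eq_bot_iff.1 h h1⟩
    · intro p q
      induction p using Quotient.inductionOn with
      | h x =>
        induction q using Quotient.inductionOn with
        | h y =>
          intro h
          apply Quotient.sound
          have h1 : g (a.toFun x) = g (a.toFun y) := Quotient.exact (s := Setoid.ker g) h
          rwa [hg, hg] at h1
    · intro p
      induction p using Quotient.inductionOn with
      | h y =>
        obtain ⟨x, hx⟩ := hg' y
        refine ⟨Quotient.mk _ x, Quotient.sound ?_⟩
        change g (a.toFun x) = g y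
        rw [hg, hx]

/-- An idempotent transformation whose partition is `π`. -/
def reprSing (P : Partn X) : Sing X where
  toFun x := (Quotient.mk P.rel x).out
  not_injective h := P.ne_bot (Setoid.ext fun x y =>
    ⟨fun hxy => h (congrArg Quotient.out (Quotient.sound hxy)),
      fun hxy => by cases hxy; exact P.rel.refl x⟩)
  not_surjective h := P.ne_bot (Setoid.ext fun x y => by
    refine ⟨fun hxy => ?_, fun hxy => by cases hxy; exact P.rel.refl x⟩
    obtain ⟨v, rfl⟩ := h x
    obtain ⟨w, rfl⟩ := h y
    have h1 := Quotient.sound (s := P.rel) hxy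
    rw [Quotient.out_eq, Quotient.out_eq] at h1
    exact congrArg Quotient.out h1)

theorem ker_reprSing (P : Partn X) : Setoid.ker (reprSing P).toFun = P.rel :=
  Setoid.ext fun _ _ => ⟨fun h => Quotient.exact (Quotient.out_injective h),
    fun h => congrArg Quotient.out (Quotient.sound h)⟩

theorem reprSing_idem (P : Partn X) (x : X) :
    (reprSing P).toFun ((reprSing P).toFun x) = (reprSing P).toFun x :=
  congrArg Quotient.out (Quotient.out_eq (Quotient.mk P.rel x))

theorem rhoCone_reprSing_idem (P : Partn X) : IsIdempotentElem (rhoCone (reprSing P)) := by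
  apply NormalCone.isIdempotentElem_of_app_vertex
  funext ⟨y, x, hx⟩
  subst hx
  exact Subtype.ext (reprSing_idem P x)

variable (X) in
/-- The isomorphism `Q : Π(X) ⥤ N*𝒫(X)`: it takes `π̄` to `H(e; -)`, where `e` is an idempotent
transformation with partition `π`, and `η*`, for `η : π_f → π_e`, to the natural transformation
`H(e; -) ⟶ H(f; -)`, `a ↦ w a`, where `w : Im f → Im e` is the map corresponding to `η`. -/
def partnToDual : Partn X ⥤ NDual (PowObj X) where
  obj P := NDual.of (rhoCone (reprSing P)) (rhoCone_reprSing_idem P)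
  map {P Q} η := NDual.ofHat _ _ _ _ (fun x => ⟨(η (Quotient.mk _ x.1)).out,
    (η (Quotient.mk _ x.1)).out, congrArg Quotient.out (Quotient.out_eq _)⟩)
  map_id P := by
    refine Eq.trans ?_ (NDual.ofHat_id _ (rhoCone_reprSing_idem P))
    congr 1
    funext ⟨y, x, hx⟩
    subst hx
    exact Subtype.ext (reprSing_idem P x)
  map_comp {P Q R} η μ := by
    refine Eq.trans ?_ (NDual.ofHat_comp _ _ _ _ (rhoCone_reprSing_idem Q) _ _ _)
    congr 1
    funext x
    apply Subtype.ext
    change (η (μ _)).out = (η (Quotient.mk _ (Quotient.out (μ _)))).out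
    rw [Quotient.out_eq]

/-- The functor `Π(X) ⥤ Π(X)` induced by a permutation `θ`:  `π̄` goes to the partition
`θ⁻¹(π)` of `X` into the sets `θ⁻¹(A)`, `A ∈ π`, and `η*` goes to `(θ η θ⁻¹)*`. -/
def permFunctor (θ : Equiv.Perm X) : Partn X ⥤ Partn X where
  obj P := ⟨Setoid.comap θ P.rel, fun h => P.ne_bot (Setoid.ext fun x y => by
    have h0 := Setoid.ext_iff.1 h
    have h1 := @h0 (θ.symm x) (θ.symm y)
    rw [Setoid.comap_rel, θ.apply_symm_apply, θ.apply_symm_apply] at h1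
    exact h1.trans ⟨fun hxy => θ.symm.injective hxy, fun hxy => congrArg θ.symm hxy⟩)⟩
  map {P Q} η := fun q =>
    Quotient.map (sa := P.rel) (sb := Setoid.comap θ P.rel) θ.symm
      (fun x y h => by
        change P.rel (θ (θ.symm x)) (θ (θ.symm y))
        rwa [θ.apply_symm_apply, θ.apply_symm_apply])
      (η (Quotient.map (sa := Setoid.comap θ Q.rel) (sb := Q.rel) θ (fun x y h => h) q))
  map_id P := by
    funext q
    induction q using Quotient.inductionOn with
    | h x => exact congrArg (Quotient.mk _) (θ.symm_apply_apply x)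
  map_comp {P Q R} η μ := by
    funext q
    have key : ∀ p : Quotient Q.rel,
        Quotient.map (sa := Setoid.comap θ Q.rel) (sb := Q.rel) θ (fun x y h => h)
          (Quotient.map (sa := Q.rel) (sb := Setoid.comap θ Q.rel) θ.symm
            (fun x y h => by
              change Q.rel (θ (θ.symm x)) (θ (θ.symm y))
              rwa [θ.apply_symm_apply, θ.apply_symm_apply]) p) = p := by
      intro p
      induction p using Quotient.inductionOn with
      | h x => exact congrArg (Quotient.mk _) (θ.apply_symm_apply x)
    change Quotient.map _ _ (η (μ _)) = Quotient.map _ _ (η (Quotient.map _ _ (Quotient.map _ _ _)))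
    rw [key]

/-- The cross-connection `Γ_θ` induced by a permutation `θ`: the functor `Π(X) ⥤ Π(X)` induced
by `θ` followed by the isomorphism of `Π(X)` with the normal dual of `𝒫(X)`. -/
def gammaPerm (θ : Equiv.Perm X) : Partn X ⥤ NDual (PowObj X) := permFunctor θ ⋙ partnToDual X

end Cones

end CrossConn

end

open CrossConn

/-! Everything reduces to transformations. The components of a normal cone in `𝒫(X)` at the
singletons define a transformation, and normality makes it singular, so the cones are exactly the
`ρᵃ`. Containment in an `H`-functor is then a condition on image and kernel (`rhoCone_mem_hSet`):
`Γ_θ(A, P)` consists of the `ρᵃ` with `Im a ⊆ A` and `a` constant on the blocks of `θ⁻¹(P)`. Natural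
transformations between `H`-functors come from maps of vertices by a Yoneda argument
(`ofHat_injective`, `ofHat_surjective`), which gives full faithfulness.

The dual sends `A` to `H(σᵉ; -)`, with `e` idempotent and `Im e = θ(A)`. Its value at `(A, P)` is
the set of `σ^{θ⁻¹aθ}` for the same transformations `a` (`mem_deltaPerm`), so `ρᵃ ↦ σ^{θ⁻¹aθ}` is
the natural candidate for a duality. On both sides the `M`-set condition says that `θ(A)` is a
transversal of `P`. Not all normal cones in `Π(X)` have to be classified: those in an `H(σᵃ; -)` are
enough. The map `a ↦ σᵃ` is not injective when `X` has two elements, since both constants give the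
same cone, but it is injective on transformations with values in a common proper subset
(`sigmaCone_inj`), and this suffices.

An arbitrary duality `χ` has no freedom. Naturality along a constant block map and along the
inclusion of a singleton expresses each value of `χ(ρᵃ)` on a block through the image under `χ` of a
constant cone (`IsDual.app_dualityMap`). The prescribed idempotent cones, which have identity
components at their vertices, determine those images (`IsDual.app_constImage`). Hence `χ(ρᵃ) =
σ^{θ⁻¹aθ}`, and the linked pairs are the image of an injective homomorphism defined on `Sing X`;
injectivity comes from the first coordinate. -/

noncomputable section

namespace CrossConn

/-! ### `H`-functors and their transformations in an arbitrary normal category. -/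

section General

variable {C : Type u} [SmallCategory C] [SubobjCat C] [NormalCat C]

namespace NormalCone

theorem star_id (γ : NormalCone C) : γ.star (𝟙 γ.vertex) = γ := by
  cases γ; simp [star]

theorem eq_star (γ τ : NormalCone C) (q : γ.vertex ⟶ τ.vertex) [Epi q]
    (h : ∀ c, τ.app c = γ.app c ≫ q) : τ = γ.star q := by
  cases τ
  simp only [star, mk.injEq, heq_eq_eq, true_and]
  exact funext h

theorem star_epiPart_incl (γ : NormalCone C) {c : C} (h : γ.vertex ≤ c) :
    γ.star (epiPart (SubobjCat.incl h)) = γ := by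
  obtain ⟨e, he⟩ := epiPart_unique (SubobjCat.incl h) (𝟙 _) (𝟙 _) (by simp) h (by simp)
  rw [← γ.star_congr _ _ e he, star_id]

theorem star_epiPart_congr (γ : NormalCone C) {d : C} {f g : γ.vertex ⟶ d} (h : f = g) :
    γ.star (epiPart f) = γ.star (epiPart g) := by
  subst h
  rfl

theorem push_le_refl (γ : NormalCone C) {c : C} (f : γ.vertex ⟶ c) :
    γ.push le_rfl f = γ.star (epiPart f) :=
  γ.star_epiPart_congr (by rw [SubobjCat.incl_refl, Category.id_comp])

theorem push_incl (γ : NormalCone C) {c d : C} (h : γ.vertex ≤ c) (k : c ≤ d) :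
    γ.push h (SubobjCat.incl k) = γ := by
  exact (γ.star_epiPart_congr (SubobjCat.incl_trans h k)).trans (γ.star_epiPart_incl _)

theorem mem_hSet_of_le (γ : NormalCone C) {c : C} (h : γ.vertex ≤ c) : γ ∈ γ.hSet c :=
  ⟨SubobjCat.incl h, (γ.star_epiPart_incl h).symm⟩

/-- A map with a section followed by an inclusion has that map as its epimorphic part, by
`epiPart_unique`. This frees membership from the chosen `im` and `epiPart`. -/
theorem mem_hSet_iff (γ τ : NormalCone C) (c : C) :
    τ ∈ γ.hSet c ↔ τ.vertex ≤ c ∧ ∃ (q : γ.vertex ⟶ τ.vertex) (s : τ.vertex ⟶ γ.vertex),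
      s ≫ q = 𝟙 _ ∧ ∀ d, τ.app d = γ.app d ≫ q := by
  constructor
  · rintro ⟨f, rfl⟩
    obtain ⟨s, hs⟩ := epiPart_section f
    exact ⟨im_le f, epiPart f, s, hs, fun d => rfl⟩
  · rintro ⟨h, q, s, hs, hq⟩
    obtain ⟨e, he⟩ := epiPart_unique (q ≫ SubobjCat.incl h) q s hs h rfl
    have : Epi q := by
      constructor
      intro Z g g' hg
      have h1 := congrArg (fun k => s ≫ k) hg
      simpa only [← Category.assoc, hs, Category.id_comp] using h1
    exact ⟨q ≫ SubobjCat.incl h, (γ.eq_star τ q hq).trans (γ.star_congr q _ e he)⟩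

/-- Two cones that generate the same `H`-functor have isomorphisms at the same objects. -/
theorem isIso_app_of_hSet_eq {ε ε' : NormalCone C} (h : ε.hSet = ε'.hSet) {c : C}
    (hc : IsIso (ε'.app c)) : IsIso (ε.app c) := by
  obtain ⟨-, q, -, -, hq⟩ := (ε'.mem_hSet_iff ε ε.vertex).1
    ((congrFun h ε.vertex).subset (ε.mem_hSet_of_le le_rfl))
  obtain ⟨-, r, -, -, hr⟩ := (ε.mem_hSet_iff ε' ε'.vertex).1
    ((congrFun h ε'.vertex).superset (ε'.mem_hSet_of_le le_rfl))
  -- The composites of `q` and `r` can be tested after an invertible component of `ε'` or `ε`, where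
  -- they cancel.
  have : IsIso q := by
    refine ⟨r, ?_, ?_⟩
    · obtain ⟨d, hd⟩ := ε'.normal
      rw [← cancel_epi (ε'.app d), ← Category.assoc, ← hq, ← hr, Category.comp_id]
    · obtain ⟨d, hd⟩ := ε.normal
      rw [← cancel_epi (ε.app d), ← Category.assoc, ← hr, ← hq, Category.comp_id]
  rw [hq]
  infer_instance

end NormalCone

namespace NDual

/-- The cone `ε` generates its `H`-functor under the action of morphisms, so the order has to be
tested on it alone. -/
theorem of_le_iff (ε : NormalCone C) (h : IsIdempotentElem ε) (F : NDual C) :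
    of ε h ≤ F ↔ ε ∈ F.toSet ε.vertex := by
  refine ⟨fun hF => hF _ (ε.mem_hSet_of_le le_rfl), ?_⟩
  rintro hε c _ ⟨f, rfl⟩
  have h1 := F.push_mem hε f
  rwa [← ε.push_le_refl]

theorem mem_mSet_of (ε : NormalCone C) (h : IsIdempotentElem ε) (c : C) :
    c ∈ (of ε h).mSet ↔ IsIso (ε.app c) :=
  ⟨fun ⟨_, _, h1, h2⟩ => NormalCone.isIso_app_of_hSet_eq h1 h2, fun hc => ⟨ε, h, rfl, hc⟩⟩

/-- An object in the `M`-set of an `H`-functor is the vertex of an idempotent cone, with identity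
component at the vertex, that generates the functor. -/
theorem exists_of_mem_mSet {F : NDual C} {c : C} (hc : c ∈ F.mSet) :
    ∃ (ε : NormalCone C) (hv : ε.vertex = c), IsIdempotentElem ε ∧ F.toSet = ε.hSet ∧
      ε.app c = eqToHom hv.symm := by
  obtain ⟨ε, hε, hF, hi⟩ := hc
  -- Composing `ε` with the inverse `v` of its component at `c` moves the vertex to `c` and makes
  -- that component the identity.
  obtain ⟨v, hv, hv'⟩ := hi.out
  have : IsIso v := ⟨_, hv', hv⟩
  have h1 : (ε.star v).app c = 𝟙 c := hv
  have h2 := (ε.star v).isIdempotentElem_of_app_vertex h1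
  refine ⟨ε.star v, rfl, h2, ?_, h1⟩
  have h3 : of ε hε = of _ h2 := by
    apply le_antisymm
    · rw [of_le_iff]
      refine (NormalCone.mem_hSet_iff _ _ _).2 ⟨le_rfl, ε.app c, v, hv', fun d => ?_⟩
      change _ = (ε.app d ≫ v) ≫ ε.app c
      rw [Category.assoc, hv', Category.comp_id]
    · rw [of_le_iff]
      exact (NormalCone.mem_hSet_iff _ _ _).2 ⟨le_rfl, v, ε.app c, hv, fun d => rfl⟩
  rw [hF]
  exact congrArg toSet h3

theorem app_naturality {F G : NDual C} (σ : F ⟶ G) {c d : C} (g : c ⟶ d) {τ : NormalCone C}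
    (h : τ ∈ F.toSet c) :
    (app σ d ⟨τ.push (F.vertex_le h) g, F.push_mem h g⟩).1 =
      (app σ c ⟨τ, h⟩).1.push (G.vertex_le (app σ c ⟨τ, h⟩).2) g := by
  have h1 := ConcreteCategory.congr_hom (σ.hom.naturality g) (⟨τ, h⟩ : F.toSet c)
  exact congrArg Subtype.val h1

theorem ofHat_injective (ε ε' : NormalCone C) (h : IsIdempotentElem ε)
    (h' : IsIdempotentElem ε') : Function.Injective (ofHat ε ε' h h') := by
  intro w w' hw
  have h1 := ofHat_apply ε ε' h h' w (𝟙 _)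
  rw [hw, ofHat_apply, Category.comp_id, Category.comp_id] at h1
  exact (ε'.star_epiPart_inj h1).symm

/-- Yoneda: `σ` is determined by the image of the generator `ε`, and that image is `ε'` followed by
the epimorphic part of some `w`. -/
theorem ofHat_surjective (ε ε' : NormalCone C) (h : IsIdempotentElem ε)
    (h' : IsIdempotentElem ε') : Function.Surjective (ofHat ε ε' h h') := by
  intro σ
  have hε : ε ∈ (of ε h).toSet ε.vertex := ε.mem_hSet_of_le le_rfl
  obtain ⟨w, hw⟩ := (app σ ε.vertex ⟨ε, hε⟩).2
  refine ⟨w, hom_ext' ?_⟩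
  rintro c ⟨_, f, rfl⟩
  rw [ofHat_apply]
  have h1 := app_naturality σ f hε
  simp only [ε.push_le_refl] at h1
  rw [h1]
  simp only [hw]
  exact (NormalCone.push_star ε' w f).symm

end NDual

end General

/-! ### Isomorphisms, epimorphic parts, transversals and separating partitions in the two categories
of a set. -/

variable {X : Type u}

theorem Sing.nonempty (a : Sing X) : Nonempty X := by
  by_contra h
  rw [not_nonempty_iff] at h
  exact a.not_injective fun x => h.elim x

namespace PowObj

theorem bijective_of_isIso {A B : PowObj X} (f : A ⟶ B) (hf : IsIso f) :
    Function.Bijective (f : A.carrier → B.carrier) := by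
  obtain ⟨g, h1, h2⟩ := hf.out
  exact ⟨Function.LeftInverse.injective (g := g) fun x => congrFun h1 x,
    Function.RightInverse.surjective (g := g) fun x => congrFun h2 x⟩

theorem epiPart_val {A B : PowObj X} (f : A ⟶ B) (x : A.carrier) :
    ((epiPart f : A.carrier → (im f).carrier) x).1 = ((f : A.carrier → B.carrier) x).1 :=
  congrArg (Subtype.val : B.carrier → X) (congrFun (epiPart_incl f) x)

/-- The one-element subset `{x}`. -/
def single [Nontrivial X] (x : X) : PowObj X :=
  ⟨{x}, Set.singleton_nonempty x, Set.singleton_ne_univ x⟩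

/-- A set of representatives of a non-identity partition is a proper subset of `X`. -/
theorem exists_transversal (P : Partn X) (y : X) : ∃ A : PowObj X, y ∈ A.carrier ∧
    Function.Bijective (fun x : A.carrier => Quotient.mk P.rel x.1) := by
  classical
  -- A section of the quotient map, altered on one block so that it passes through `y`; its range is
  -- the transversal.
  let s : Quotient P.rel → X := fun p => if p = Quotient.mk _ y then y else p.out
  have hs : ∀ p, Quotient.mk P.rel (s p) = p := by
    intro p
    by_cases h : p = Quotient.mk _ y
    · rw [h]
      exact congrArg _ (if_pos rfl)
    · simp only [s, if_neg h, Quotient.out_eq]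
  have hy : s (Quotient.mk _ y) = y := if_pos rfl
  refine ⟨⟨Set.range s, ⟨_, _, hy⟩, fun h => P.ne_bot (Setoid.ext fun v w => ?_)⟩, ⟨_, hy⟩, ?_, ?_⟩
  · refine ⟨fun hvw => ?_, fun hvw => by cases hvw; exact P.rel.refl v⟩
    obtain ⟨p, rfl⟩ := Set.range_eq_univ.1 h v
    obtain ⟨q, rfl⟩ := Set.range_eq_univ.1 h w
    have h1 := Quotient.sound (s := P.rel) hvw
    rw [hs, hs] at h1
    exact congrArg s h1
  · rintro ⟨_, p, rfl⟩ ⟨_, q, rfl⟩ h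
    simp only [hs] at h
    simp only [h]
  · exact fun p => ⟨⟨s p, p, rfl⟩, hs p⟩

end PowObj

namespace Partn

theorem bijective_of_isIso {P Q : Partn X} (f : P ⟶ Q) (hf : IsIso f) :
    Function.Bijective (f : Quotient Q.rel → Quotient P.rel) := by
  obtain ⟨g, h1, h2⟩ := hf.out
  exact ⟨Function.LeftInverse.injective (g := g) fun x => congrFun h2 x,
    Function.RightInverse.surjective (g := g) fun x => congrFun h1 x⟩

theorem epiPart_mk {P Q : Partn X} (f : P ⟶ Q) (x : X) :
    (epiPart f : Quotient (im f).rel → Quotient P.rel) (Quotient.mk _ x) =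
      (f : Quotient Q.rel → Quotient P.rel) (Quotient.mk _ x) :=
  congrFun (epiPart_incl f) (Quotient.mk _ x)

theorem eqToHom_mk {P Q : Partn X} (h : P = Q) (x : X) :
    (eqToHom h : Quotient Q.rel → Quotient P.rel) (Quotient.mk _ x) = Quotient.mk _ x := by
  subst h
  rfl

/-- Glue a point `w` outside `A` to a point `z` of `A` and leave everything else alone: the
partition is not the identity, yet it separates the points of `A`. -/
theorem exists_separating {A : Set X} (hA : A ≠ Set.univ) (hA' : A.Nonempty) : ∃ P : Partn X,
    ∀ x ∈ A, ∀ y ∈ A, Quotient.mk P.rel x = Quotient.mk P.rel y → x = y := by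
  classical
  obtain ⟨w, hw⟩ := (Set.ne_univ_iff_exists_notMem A).1 hA
  obtain ⟨z, hz⟩ := hA'
  have hne : ∀ x ∈ A, x ≠ w := fun x hx h => hw (h ▸ hx)
  refine ⟨⟨Setoid.ker (Function.update id w z), fun h => ?_⟩, fun x hx y hy h => ?_⟩
  · refine hne z hz (Setoid.ker_eq_bot_iff.1 h ?_)
    rw [Function.update_self, Function.update_of_ne (hne z hz)]
    rfl
  · have h1 : Function.update id w z x = Function.update id w z y :=
      Quotient.exact (s := Setoid.ker _) h
    rwa [Function.update_of_ne (hne x hx), Function.update_of_ne (hne y hy)] at h1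

/-- The partition of `X` with a single block. -/
def top [Nontrivial X] : Partn X := ⟨⊤, fun h => by
  obtain ⟨x, y, hxy⟩ := exists_pair_ne X
  exact hxy ((Setoid.ext_iff.1 h x y).1 trivial)⟩

end Partn

/-- A map that is constant on the blocks of a non-identity partition and takes its values in a
proper subset. -/
def Sing.ofFactor (P : Partn X) (A : Set X) (hA : A ≠ Set.univ) (b : X → X)
    (hb : ∀ x, b x ∈ A) (hb' : ∀ x y, P.rel x y → b x = b y) : Sing X where
  toFun := b
  not_injective h := P.ne_bot (Setoid.ext fun x y =>
    ⟨fun hxy => h (hb' x y hxy), fun hxy => by cases hxy; exact P.rel.refl x⟩)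
  not_surjective h := hA (Set.eq_univ_of_forall fun y => by
    obtain ⟨x, rfl⟩ := h y
    exact hb x)

/-! ### Normal cones in the powerset category -/

section Rho

variable [Nontrivial X]

/-- The vertex need not be assumed equal to `Im a`: an invertible component is onto the vertex, and
the singletons show that `Im a` lies inside it. -/
theorem eq_rhoCone (τ : NormalCone (PowObj X)) (a : Sing X)
    (h : ∀ (A : PowObj X) (x : A.carrier),
      ((τ.app A : A.carrier → τ.vertex.carrier) x).1 = a.toFun x.1) : τ = rhoCone a := by
  have hv : τ.vertex = (rhoCone a).vertex := by
    apply PowObj.ext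
    ext y
    constructor
    · intro hy
      obtain ⟨A, hA⟩ := τ.normal
      obtain ⟨x, hx⟩ := (PowObj.bijective_of_isIso _ hA).2 ⟨y, hy⟩
      exact ⟨x.1, (h A x).symm.trans (congrArg Subtype.val hx)⟩
    · rintro ⟨x, rfl⟩
      have h1 := h (PowObj.single x) ⟨x, rfl⟩
      rw [← h1]
      exact Subtype.property _
  obtain ⟨v, app, h1, h2⟩ := τ
  change v = _ at hv
  subst hv
  have h3 : app = (rhoCone a).app := by
    funext A x
    exact Subtype.ext (h A x)
  subst h3
  rfl

/-- Compatibility with the inclusions of singletons makes every component a restriction of one map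
`b` of `X`. -/
theorem exists_eq_rhoCone (τ : NormalCone (PowObj X)) : ∃ a : Sing X, τ = rhoCone a := by
  let b : X → X := fun x => ((τ.app (PowObj.single x) :
    (PowObj.single x).carrier → τ.vertex.carrier) ⟨x, rfl⟩).1
  have hb : ∀ (A : PowObj X) (x : A.carrier),
      ((τ.app A : A.carrier → τ.vertex.carrier) x).1 = b x.1 := by
    intro A x
    have h1 : PowObj.single x.1 ≤ A := by
      rintro _ rfl
      exact x.2
    exact congrArg (Subtype.val : τ.vertex.carrier → X)
      (congrFun (τ.compat h1) ⟨x.1, rfl⟩)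
  refine ⟨⟨b, fun h => ?_, fun h => ?_⟩, eq_rhoCone τ _ hb⟩
  · obtain ⟨A, hA⟩ := τ.normal
    -- A point `z` outside `A` has its value under `b` already attained on `A`, because the
    -- component at `A` is onto the vertex.
    obtain ⟨z, hz⟩ := (Set.ne_univ_iff_exists_notMem _).1 A.ne_univ
    obtain ⟨x, hx⟩ := (PowObj.bijective_of_isIso _ hA).2 ⟨b z, Subtype.property _⟩
    have h1 : b x.1 = b z := (hb A x).symm.trans (congrArg Subtype.val hx)
    exact hz (h h1 ▸ x.2)
  · refine τ.vertex.ne_univ (Set.eq_univ_of_forall fun y => ?_)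
    obtain ⟨x, rfl⟩ := h y
    exact Subtype.property _

theorem rhoCone_injective : Function.Injective (rhoCone : Sing X → _) := by
  intro a b h
  apply Sing.ext
  funext x
  exact congrArg (fun τ : NormalCone (PowObj X) => ((τ.app (PowObj.single x) :
    (PowObj.single x).carrier → τ.vertex.carrier) ⟨x, rfl⟩).1) h

theorem rhoCone_star (a b : Sing X) {A : PowObj X} (f : (rhoCone a).vertex ⟶ A)
    (h : ∀ x, ((f : (rhoCone a).vertex.carrier → A.carrier) ⟨a.toFun x, x, rfl⟩).1 = b.toFun x) :
    (rhoCone a).star (epiPart f) = rhoCone b :=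
  eq_rhoCone _ b fun _ x => (PowObj.epiPart_val f _).trans (h x.1)

/-- Membership means that `b` is `a` followed by a map from `Im a` to `A`; such a map exists exactly
when the kernel of `a` lies in that of `b` and `Im b ⊆ A`. -/
theorem rhoCone_mem_hSet {a b : Sing X} {A : PowObj X} :
    rhoCone b ∈ (rhoCone a).hSet A ↔ (∀ x, b.toFun x ∈ A.carrier) ∧
      ∀ x y, a.toFun x = a.toFun y → b.toFun x = b.toFun y := by
  constructor
  · intro h
    obtain ⟨h1, q, -, -, hq⟩ := (NormalCone.mem_hSet_iff _ _ _).1 h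
    refine ⟨fun x => h1 ⟨x, rfl⟩, fun x y hxy => ?_⟩
    have key : ∀ x, b.toFun x = ((q : (rhoCone a).vertex.carrier → (rhoCone b).vertex.carrier)
        ⟨a.toFun x, x, rfl⟩).1 := fun x =>
      congrArg (Subtype.val : (rhoCone b).vertex.carrier → X)
        (congrFun (hq (PowObj.single x)) ⟨x, rfl⟩)
    rw [key, key]
    simp only [hxy]
  · rintro ⟨h1, h2⟩
    refine ⟨fun y => ⟨b.toFun y.2.choose, h1 _⟩, (rhoCone_star a b _ fun x => ?_).symm⟩
    exact h2 _ _ (Exists.choose_spec (⟨x, rfl⟩ : ∃ z, a.toFun z = a.toFun x))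

theorem rhoCone_push (a b : Sing X) {A B : PowObj X} (h : (rhoCone a).vertex ≤ A) (g : A ⟶ B)
    (hb : ∀ x, ((g : A.carrier → B.carrier) ⟨a.toFun x, h ⟨x, rfl⟩⟩).1 = b.toFun x) :
    (rhoCone a).push h g = rhoCone b :=
  rhoCone_star a b _ hb

theorem rhoCone_mul (a b : Sing X) : rhoCone a * rhoCone b = rhoCone (a * b) :=
  rhoCone_star a (a * b) _ fun _ => rfl

end Rho

/-! ### Normal cones in the category of partitions -/

section Sigma

/-- The vertex is forced to be the kernel partition of `a`: a partition separating `Im a` gives one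
containment, and an injective component of `τ` gives the other. -/
theorem eq_sigmaCone (τ : NormalCone (Partn X)) (a : Sing X)
    (h : ∀ (P : Partn X) (x : X), (τ.app P : Quotient τ.vertex.rel → Quotient P.rel)
      (Quotient.mk _ x) = Quotient.mk _ (a.toFun x)) : τ = sigmaCone a := by
  have hv : τ.vertex = (sigmaCone a).vertex := by
    apply Partn.ext
    ext x y
    constructor
    · intro hxy
      have := a.nonempty
      obtain ⟨P, hP⟩ := Partn.exists_separating (A := Set.range a.toFun)
        (fun h => a.not_surjective (Set.range_eq_univ.1 h)) (Set.range_nonempty _)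
      refine hP _ ⟨x, rfl⟩ _ ⟨y, rfl⟩ ?_
      rw [← h P, ← h P, Quotient.sound hxy]
    · intro hxy
      obtain ⟨P, hP⟩ := τ.normal
      apply Quotient.exact (s := τ.vertex.rel)
      apply (Partn.bijective_of_isIso _ hP).1
      have h1 : a.toFun x = a.toFun y := hxy
      rw [h, h, h1]
  obtain ⟨v, app, h1, h2⟩ := τ
  change v = _ at hv
  subst hv
  have h3 : app = (sigmaCone a).app := by
    funext P p
    induction p using Quotient.inductionOn with
    | h x => exact h P x
  subst h3
  rfl

theorem sigmaCone_star (a b : Sing X) {P : Partn X} (f : (sigmaCone a).vertex ⟶ P)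
    (h : ∀ x y, (f : Quotient P.rel → Quotient (Setoid.ker a.toFun)) (Quotient.mk _ x) =
      Quotient.mk _ y → a.toFun y = b.toFun x) :
    (sigmaCone a).star (epiPart f) = sigmaCone b := by
  refine eq_sigmaCone _ b fun Q x => ?_
  change ((sigmaCone a).app Q : Quotient (sigmaCone a).vertex.rel → Quotient Q.rel)
    ((epiPart f : Quotient (im f).rel → Quotient (sigmaCone a).vertex.rel) (Quotient.mk _ x)) = _
  rw [Partn.epiPart_mk]
  obtain ⟨y, hy⟩ := Quotient.exists_rep
    ((f : Quotient P.rel → Quotient (Setoid.ker a.toFun)) (Quotient.mk _ x))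
  have h1 := h x y hy.symm
  rw [← h1]
  exact congrArg ((sigmaCone a).app Q : Quotient (sigmaCone a).vertex.rel → Quotient Q.rel) hy.symm

/-- Stated for an arbitrary cone `τ`, so that it also provides the transformation behind `τ`; this
replaces a classification of all cones in `Π(X)`. -/
theorem mem_hSet_sigmaCone {a : Sing X} {P : Partn X} {τ : NormalCone (Partn X)} :
    τ ∈ (sigmaCone a).hSet P ↔ ∃ b : Sing X, τ = sigmaCone b ∧
      (∀ x, b.toFun x ∈ Set.range a.toFun) ∧ ∀ x y, P.rel x y → b.toFun x = b.toFun y := by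
  constructor
  · rintro ⟨f, rfl⟩
    let f' : Quotient P.rel → Quotient (Setoid.ker a.toFun) := f
    let b : X → X := fun x => a.toFun (f' (Quotient.mk _ x)).out
    have hb : ∀ x y, P.rel x y → b x = b y := fun x y hxy =>
      congrArg (fun p => a.toFun (f' p).out) (Quotient.sound hxy)
    refine ⟨Sing.ofFactor P (Set.range a.toFun)
      (fun h => a.not_surjective (Set.range_eq_univ.1 h)) b (fun x => ⟨_, rfl⟩) hb,
      sigmaCone_star a _ f fun x y hxy => ?_, fun x => ⟨_, rfl⟩, hb⟩
    have h1 : (f' (Quotient.mk _ x)).out = (Quotient.mk (Setoid.ker a.toFun) y).out :=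
      congrArg Quotient.out hxy
    change _ = a.toFun (f' (Quotient.mk _ x)).out
    rw [h1]
    exact (Quotient.exact (s := Setoid.ker a.toFun) (Quotient.out_eq _)).symm
  · rintro ⟨b, rfl, h1, h2⟩
    refine ⟨Quotient.lift (s := P.rel) (fun x => Quotient.mk (Setoid.ker a.toFun) (h1 x).choose)
      fun x y hxy => ?_, (sigmaCone_star a b _ fun x y hxy => ?_).symm⟩
    · apply Quotient.sound
      change a.toFun _ = a.toFun _
      rw [(h1 x).choose_spec, (h1 y).choose_spec, h2 x y hxy]
    · have h3 : a.toFun (h1 x).choose = a.toFun y := Quotient.exact (s := Setoid.ker a.toFun) hxy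
      rw [← h3, (h1 x).choose_spec]

theorem sigmaCone_push (a b : Sing X) {P Q : Partn X} (h : (sigmaCone a).vertex ≤ P) (g : P ⟶ Q)
    (hb : ∀ x y, (g : Quotient Q.rel → Quotient P.rel) (Quotient.mk _ x) = Quotient.mk _ y →
      a.toFun y = b.toFun x) :
    (sigmaCone a).push h g = sigmaCone b := by
  refine sigmaCone_star a b _ fun x y hxy => ?_
  obtain ⟨z, hz⟩ := Quotient.exists_rep
    ((g : Quotient Q.rel → Quotient P.rel) (Quotient.mk _ x))
  rw [← hb x z hz.symm]
  have h1 : Quotient.mk (Setoid.ker a.toFun) z = Quotient.mk (Setoid.ker a.toFun) y := by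
    exact (congrArg (SubobjCat.incl h :
      Quotient P.rel → Quotient (Setoid.ker a.toFun)) hz).trans hxy
  exact (Quotient.exact (s := Setoid.ker a.toFun) h1).symm

/-- Block maps run against the morphisms they represent, which reverses the order of the factors. -/
theorem sigmaCone_mul (a b : Sing X) : sigmaCone b * sigmaCone a = sigmaCone (a * b) :=
  sigmaCone_star b (a * b) _ fun _ _ hxy =>
    (Quotient.exact (s := Setoid.ker b.toFun) hxy).symm

theorem sigmaCone_idem {a : Sing X} (h : ∀ x, a.toFun (a.toFun x) = a.toFun x) :
    IsIdempotentElem (sigmaCone a) := by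
  refine (sigmaCone_mul a a).trans (congrArg _ ?_)
  exact Sing.ext (funext h)

/-- The component at one partition separating the points of `A` recovers the transformation. Without
a common `A` this fails for two-element `X`. -/
theorem sigmaCone_inj {A : PowObj X} {a b : Sing X} (ha : ∀ x, a.toFun x ∈ A.carrier)
    (hb : ∀ x, b.toFun x ∈ A.carrier) (h : sigmaCone a = sigmaCone b) : a = b := by
  obtain ⟨P, hP⟩ := Partn.exists_separating A.ne_univ A.nonempty
  -- The vertex occurs in the type of the component, so the equality of cones is substituted for a
  -- general `τ`.
  have key : ∀ (τ : NormalCone (Partn X)) (ht : τ = sigmaCone b) (x : X),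
      (τ.app P : Quotient τ.vertex.rel → Quotient P.rel) (Quotient.mk _ x) =
        Quotient.mk _ (b.toFun x) := by
    rintro _ rfl x
    rfl
  exact Sing.ext (funext fun x => hP _ (ha x) _ (hb x) (key _ h x))

end Sigma

/-- `a` takes its values in `A` and is constant on the blocks of the partition `θ⁻¹(P)`. -/
def Sing.FactorsThrough (θ : Equiv.Perm X) (A : PowObj X) (P : Partn X) (a : Sing X) : Prop :=
  (∀ x, a.toFun x ∈ A.carrier) ∧ ∀ x y, P.rel (θ x) (θ y) → a.toFun x = a.toFun y

theorem sigmaCone_conj_inj (θ : Equiv.Perm X) {A : PowObj X} {a b : Sing X}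
    (ha : ∀ x, a.toFun x ∈ A.carrier) (hb : ∀ x, b.toFun x ∈ A.carrier)
    (h : sigmaCone (a.conj θ) = sigmaCone (b.conj θ)) : a = b := by
  let B : PowObj X := ⟨θ '' A.carrier, A.nonempty.image _, fun h => A.ne_univ (by
    rw [← Set.preimage_image_eq A.carrier θ.injective, h, Set.preimage_univ])⟩
  have h1 := sigmaCone_inj (A := B) (a := a.conj θ) (b := b.conj θ)
    (fun x => ⟨_, ha _, rfl⟩) (fun x => ⟨_, hb _, rfl⟩) h
  apply Sing.ext
  funext x
  have h2 := congrFun (congrArg Sing.toFun h1) (θ x)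
  apply θ.injective
  simpa [Sing.conj] using h2

theorem Sing.conj_mul (θ : Equiv.Perm X) (a b : Sing X) :
    (a * b).conj θ = a.conj θ * b.conj θ := by
  apply Sing.ext
  funext x
  change θ (b.toFun (a.toFun (θ.symm x))) = θ (b.toFun (θ.symm (θ (a.toFun (θ.symm x)))))
  rw [θ.symm_apply_apply]

/-- The constant transformation with value `y`. -/
def Sing.const [Nontrivial X] (y : X) : Sing X :=
  Sing.ofFactor Partn.top {y} (Set.singleton_ne_univ y) (fun _ => y) (fun _ => rfl)
    fun _ _ _ => rfl

theorem reprSing_eq_iff (P : Partn X) {x y : X} :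
    (reprSing P).toFun x = (reprSing P).toFun y ↔ P.rel x y := by
  rw [← Setoid.ker_def, ker_reprSing]

open Classical in
/-- An idempotent transformation with image `A`. -/
def retr (A : PowObj X) : Sing X where
  toFun x := if x ∈ A.carrier then x else A.nonempty.some
  not_injective h := by
    obtain ⟨w, hw⟩ := (Set.ne_univ_iff_exists_notMem _).1 A.ne_univ
    refine hw (h (a₁ := w) (a₂ := A.nonempty.some) ?_ ▸ A.nonempty.some_mem)
    simp only [if_neg hw, if_pos A.nonempty.some_mem]
  not_surjective h := A.ne_univ (Set.eq_univ_of_forall fun y => by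
    obtain ⟨x, rfl⟩ := h y
    by_cases hx : x ∈ A.carrier
    · simpa only [if_pos hx] using hx
    · simpa only [if_neg hx] using A.nonempty.some_mem)

theorem retr_of_mem {A : PowObj X} {x : X} (hx : x ∈ A.carrier) : (retr A).toFun x = x :=
  if_pos hx

theorem retr_mem (A : PowObj X) (x : X) : (retr A).toFun x ∈ A.carrier := by
  by_cases hx : x ∈ A.carrier
  · rwa [retr_of_mem hx]
  · have h1 : (retr A).toFun x = A.nonempty.some := if_neg hx
    rw [h1]
    exact A.nonempty.some_mem

/-! ### The cross-connection `Γ_θ` -/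

section Gamma

/-- The image of `reprSing Q` meets every block of `Q`, so the map of images attached to a block map
still determines it. -/
instance partnToDual_faithful : (partnToDual X).Faithful where
  map_injective {P Q} η η' h := by
    have h1 := NDual.ofHat_injective _ _ _ _ h
    funext q
    induction q using Quotient.inductionOn with
    | h x =>
      have h2 := congrArg (Subtype.val : (rhoCone (reprSing P)).vertex.carrier → X)
        (congrFun h1 ⟨(reprSing Q).toFun x, x, rfl⟩)
      have h3 : Quotient.mk Q.rel ((reprSing Q).toFun x) = Quotient.mk Q.rel x :=
        Quotient.out_eq _
      have h4 := Quotient.out_injective h2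
      change (η : Quotient Q.rel → Quotient P.rel) (Quotient.mk Q.rel ((reprSing Q).toFun x)) =
        (η' : Quotient Q.rel → Quotient P.rel) (Quotient.mk Q.rel ((reprSing Q).toFun x)) at h4
      rwa [h3] at h4

instance partnToDual_full : (partnToDual X).Full where
  map_surjective {P Q} σ := by
    obtain ⟨w, rfl⟩ := NDual.ofHat_surjective _ _ (rhoCone_reprSing_idem P)
      (rhoCone_reprSing_idem Q) σ
    let w' : (rhoCone (reprSing Q)).vertex.carrier → (rhoCone (reprSing P)).vertex.carrier := w
    refine ⟨fun q => Quotient.mk P.rel (w' ⟨q.out, q.out,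
      congrArg Quotient.out (Quotient.out_eq q)⟩).1, ?_⟩
    change NDual.ofHat _ _ _ _ _ = _
    congr 1
    funext ⟨y, x, hx⟩
    subst hx
    apply Subtype.ext
    change (reprSing P).toFun (w' ⟨(Quotient.mk Q.rel ((reprSing Q).toFun x)).out, _⟩).1 =
      (w' ⟨(reprSing Q).toFun x, x, rfl⟩).1
    have h1 : (Quotient.mk Q.rel ((reprSing Q).toFun x)).out = (reprSing Q).toFun x :=
      reprSing_idem Q x
    simp only [h1]
    obtain ⟨z, hz⟩ := (w' ⟨(reprSing Q).toFun x, x, rfl⟩).2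
    rw [← hz, reprSing_idem]

variable (θ : Equiv.Perm X)

/-- The bijection of the blocks of `θ⁻¹(P)` with the blocks of `P`. -/
def permBlocks (P : Partn X) :
    Quotient ((permFunctor θ).obj P).rel ≃ Quotient P.rel where
  toFun := Quotient.map (sa := Setoid.comap θ P.rel) (sb := P.rel) θ (fun _ _ h => h)
  invFun := Quotient.map (sa := P.rel) (sb := Setoid.comap θ P.rel) θ.symm fun x y h => by
    change P.rel (θ (θ.symm x)) (θ (θ.symm y))
    rwa [θ.apply_symm_apply, θ.apply_symm_apply]
  left_inv p := by
    induction p using Quotient.inductionOn with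
    | h x => exact congrArg (Quotient.mk _) (θ.symm_apply_apply x)
  right_inv p := by
    induction p using Quotient.inductionOn with
    | h x => exact congrArg (Quotient.mk _) (θ.apply_symm_apply x)

theorem permFunctor_map {P Q : Partn X} (η : P ⟶ Q) (q : Quotient ((permFunctor θ).obj Q).rel) :
    ((permFunctor θ).map η : Quotient ((permFunctor θ).obj Q).rel →
        Quotient ((permFunctor θ).obj P).rel) q =
      (permBlocks θ P).symm ((η : Quotient Q.rel → Quotient P.rel) (permBlocks θ Q q)) :=
  rfl

instance permFunctor_faithful : (permFunctor θ).Faithful where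
  map_injective {P Q} η η' h := by
    funext q
    obtain ⟨p, rfl⟩ := (permBlocks θ Q).surjective q
    exact (permBlocks θ P).symm.injective (congrFun h p)

instance permFunctor_full : (permFunctor θ).Full where
  map_surjective {P Q} ζ := by
    refine ⟨fun q => permBlocks θ P ((ζ : Quotient ((permFunctor θ).obj Q).rel →
      Quotient ((permFunctor θ).obj P).rel) ((permBlocks θ Q).symm q)), ?_⟩
    funext q
    rw [permFunctor_map, Equiv.symm_apply_apply, Equiv.symm_apply_apply]

variable {θ}

/-- The image of the chosen idempotent is a transversal of `θ⁻¹(P)`. Identifying it with the blocks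
of `P` turns the component at `A` into the block map of `θ` on `A`. -/
theorem mem_mSet_gammaPerm {A : PowObj X} {P : Partn X} :
    A ∈ ((gammaPerm θ).obj P).mSet ↔
      Function.Bijective (fun x : A.carrier => Quotient.mk P.rel (θ x.1)) := by
  refine (NDual.mem_mSet_of _ (rhoCone_reprSing_idem _) _).trans ?_
  let e := reprSing ((permFunctor θ).obj P)
  let k : (rhoCone e).vertex.carrier → Quotient P.rel := fun y => Quotient.mk P.rel (θ y.1)
  have he : ∀ x, P.rel (θ (e.toFun x)) (θ x) := fun x =>
    (reprSing_eq_iff ((permFunctor θ).obj P)).1 (reprSing_idem _ x)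
  have hk : Function.Bijective k := by
    constructor
    · rintro ⟨_, x, rfl⟩ ⟨_, y, rfl⟩ h
      apply Subtype.ext
      change e.toFun x = e.toFun y
      refine (reprSing_eq_iff ((permFunctor θ).obj P)).2 ?_
      have h1 : P.rel (θ (e.toFun x)) (θ (e.toFun y)) := Quotient.exact h
      exact P.rel.trans (P.rel.symm (he x)) (P.rel.trans h1 (he y))
    · intro p
      induction p using Quotient.inductionOn with
      | h z =>
        refine ⟨⟨e.toFun (θ.symm z), _, rfl⟩, Quotient.sound ?_⟩
        have h1 := he (θ.symm z)
        rwa [θ.apply_symm_apply] at h1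
  have h1 : (fun x : A.carrier => Quotient.mk P.rel (θ x.1)) =
      k ∘ ((rhoCone e).app A : A.carrier → (rhoCone e).vertex.carrier) :=
    funext fun x => (Quotient.sound (he x.1)).symm
  rw [h1, hk.of_comp_iff']
  exact ⟨fun h => PowObj.bijective_of_isIso _ h, fun h => PowObj.isIso_of_bijective _ h⟩

variable [Nontrivial X]

theorem rhoCone_mem_gammaPerm {a : Sing X} {A : PowObj X} {P : Partn X} :
    rhoCone a ∈ ((gammaPerm θ).obj P).toSet A ↔ a.FactorsThrough θ A P := by
  refine rhoCone_mem_hSet.trans (and_congr Iff.rfl (forall₂_congr fun x y => ?_))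
  exact imp_congr (reprSing_eq_iff _) Iff.rfl

/-- The result is described by a relation between `a` and `b` on blocks, which keeps the chosen
representatives out of later arguments. -/
theorem gammaPerm_map_app {P Q : Partn X} (η : P ⟶ Q) {A : PowObj X} {a : Sing X}
    (h : rhoCone a ∈ ((gammaPerm θ).obj P).toSet A) (b : Sing X)
    (hb : ∀ x y, (η : Quotient Q.rel → Quotient P.rel) (Quotient.mk _ (θ x)) =
      Quotient.mk _ (θ y) → a.toFun y = b.toFun x) :
    (NDual.app ((gammaPerm θ).map η) A ⟨rhoCone a, h⟩).1 = rhoCone b := by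
  obtain ⟨h1, h2⟩ := rhoCone_mem_gammaPerm.1 h
  let f : (rhoCone (reprSing ((permFunctor θ).obj P))).vertex ⟶ A := fun y => ⟨a.toFun y.1, h1 _⟩
  have hτ : rhoCone a = (rhoCone (reprSing ((permFunctor θ).obj P))).star (epiPart f) := by
    refine (rhoCone_star _ a f fun x => ?_).symm
    exact h2 _ _ ((reprSing_eq_iff ((permFunctor θ).obj P)).1 (reprSing_idem _ x))
  have hτ' : (⟨rhoCone a, h⟩ : ((gammaPerm θ).obj P).toSet A) = ⟨_, f, rfl⟩ := Subtype.ext hτ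
  rw [hτ']
  refine (NDual.ofHat_apply _ _ _ _ _ f).trans (rhoCone_star _ b _ fun x => ?_)
  obtain ⟨z, hz⟩ := Quotient.exists_rep
    ((η : Quotient Q.rel → Quotient P.rel) (Quotient.mk _ (θ x)))
  rw [← θ.apply_symm_apply z] at hz
  rw [← hb x _ hz.symm]
  have h3 : Quotient.mk ((permFunctor θ).obj Q).rel
      ((reprSing ((permFunctor θ).obj Q)).toFun x) = Quotient.mk _ x := Quotient.out_eq _
  have h4 : ((permFunctor θ).map η : Quotient ((permFunctor θ).obj Q).rel →
      Quotient ((permFunctor θ).obj P).rel) (Quotient.mk _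
        ((reprSing ((permFunctor θ).obj Q)).toFun x)) = Quotient.mk _ (θ.symm z) := by
    rw [h3, permFunctor_map, Equiv.symm_apply_eq]
    exact hz.symm
  change a.toFun (((permFunctor θ).map η : Quotient ((permFunctor θ).obj Q).rel →
      Quotient ((permFunctor θ).obj P).rel) (Quotient.mk _
        ((reprSing ((permFunctor θ).obj Q)).toFun x))).out = _
  rw [h4]
  exact h2 _ _ ((reprSing_eq_iff ((permFunctor θ).obj P)).1 (reprSing_idem _ _))

theorem gammaPerm_map_incl {P Q : Partn X} (h : P ≤ Q) :
    ∃ k : (gammaPerm θ).obj P ≤ (gammaPerm θ).obj Q,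
      (gammaPerm θ).map (SubobjCat.incl h) = SubobjCat.incl k := by
  have k : (gammaPerm θ).obj P ≤ (gammaPerm θ).obj Q := by
    intro A τ hτ
    obtain ⟨a, rfl⟩ := exists_eq_rhoCone τ
    rw [rhoCone_mem_gammaPerm] at hτ ⊢
    exact ⟨hτ.1, fun x y hxy => hτ.2 x y (h hxy)⟩
  refine ⟨k, NDual.hom_ext' ?_⟩
  rintro A ⟨τ, hτ⟩
  obtain ⟨a, rfl⟩ := exists_eq_rhoCone τ
  refine gammaPerm_map_app _ hτ a fun x y hxy => ?_
  exact ((rhoCone_mem_gammaPerm.1 hτ).2 x y (Quotient.exact (s := P.rel) hxy)).symm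

theorem gammaPerm_le_of_obj_le {P Q : Partn X}
    (h : (gammaPerm θ).obj P ≤ (gammaPerm θ).obj Q) : P ≤ Q := by
  have h1 := (NDual.of_le_iff _ (rhoCone_reprSing_idem _) _).1 h
  have h2 := (rhoCone_mem_gammaPerm.1 h1).2
  intro x y hxy
  have h3 := (reprSing_eq_iff ((permFunctor θ).obj P)).1 (h2 (θ.symm x) (θ.symm y)
    (by rwa [θ.apply_symm_apply, θ.apply_symm_apply]))
  change P.rel (θ (θ.symm x)) (θ (θ.symm y)) at h3
  rwa [θ.apply_symm_apply, θ.apply_symm_apply] at h3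

theorem gammaPerm_isCrossConnection : IsCrossConnection (gammaPerm θ) where
  localIso :=
    { map_incl := gammaPerm_map_incl
      full := inferInstanceAs (permFunctor θ ⋙ partnToDual X).Full
      faithful := inferInstanceAs (permFunctor θ ⋙ partnToDual X).Faithful
      ideal := by
        intro P
        refine ⟨fun Q hQ => (gammaPerm_map_incl hQ).choose, fun Q _ R _ h =>
          le_antisymm (gammaPerm_le_of_obj_le h.le) (gammaPerm_le_of_obj_le h.ge), ?_⟩
        rintro ⟨_, ε, hε, rfl⟩ hF
        have h1 := (NDual.of_le_iff ε hε ((gammaPerm θ).obj P)).1 hF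
        obtain ⟨a, rfl⟩ := exists_eq_rhoCone ε
        have h2 := (rhoCone_mem_gammaPerm.1 h1).2
        -- The partition into the `θ`-images of the fibres of `a`; pulled back along `θ`, it becomes
        -- the kernel of `a`.
        refine ⟨⟨Setoid.ker fun x => a.toFun (θ.symm x), fun h => a.not_injective ?_⟩, ?_, ?_⟩
        · have h3 : Function.Injective (a.toFun ∘ θ.symm) := Setoid.ker_eq_bot_iff.1 h
          exact (Function.Injective.of_comp_iff' _ θ.symm.bijective).1 h3
        · intro x y hxy
          exact h2 _ _ (by rwa [θ.apply_symm_apply, θ.apply_symm_apply])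
        · apply NDual.ext
          funext A
          ext τ
          obtain ⟨b, rfl⟩ := exists_eq_rhoCone τ
          rw [rhoCone_mem_gammaPerm]
          refine Iff.trans ?_ rhoCone_mem_hSet.symm
          refine and_congr Iff.rfl (forall₂_congr fun x y => imp_congr ?_ Iff.rfl)
          change a.toFun (θ.symm (θ x)) = a.toFun (θ.symm (θ y)) ↔ _
          rw [θ.symm_apply_apply, θ.symm_apply_apply] }
  total A := by
    -- The conjugated retraction is idempotent with image `θ(A)`, so `θ(A)` is a transversal of its
    -- kernel partition.
    refine ⟨⟨Setoid.ker ((retr A).conj θ).toFun,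
      fun h => ((retr A).conj θ).not_injective (Setoid.ker_eq_bot_iff.1 h)⟩,
      mem_mSet_gammaPerm.2 ⟨fun x y h => ?_, fun p => ?_⟩⟩
    · have h0 : Setoid.ker ((retr A).conj θ).toFun (θ x.1) (θ y.1) := Quotient.exact h
      have h1 : θ ((retr A).toFun (θ.symm (θ x.1))) = θ ((retr A).toFun (θ.symm (θ y.1))) := h0
      rw [θ.symm_apply_apply, θ.symm_apply_apply, retr_of_mem x.2, retr_of_mem y.2] at h1
      exact Subtype.ext (θ.injective h1)
    · induction p using Quotient.inductionOn with
      | h v =>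
        refine ⟨⟨(retr A).toFun (θ.symm v), retr_mem _ _⟩, Quotient.sound ?_⟩
        change θ ((retr A).toFun (θ.symm (θ _))) = θ ((retr A).toFun (θ.symm v))
        rw [θ.symm_apply_apply, retr_of_mem (retr_mem _ _)]

end Gamma

/-! ### The dual of `Γ_θ` -/

section Delta

variable (θ : Equiv.Perm X)

theorem Sing.conj_symm_conj (a : Sing X) : (a.conj θ.symm).conj θ = a := by
  apply Sing.ext
  funext x
  simp [Sing.conj]

theorem retr_conj_idem (A : PowObj X) (x : X) :
    ((retr A).conj θ).toFun (((retr A).conj θ).toFun x) = ((retr A).conj θ).toFun x := by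
  change θ ((retr A).toFun (θ.symm (θ _))) = θ _
  rw [θ.symm_apply_apply, retr_of_mem (retr_mem _ _)]

/-- The map of blocks defined by a map `g : A → B`, for the partitions defined by idempotents with
images `θ(A)` and `θ(B)`. -/
def retrBlocks {A B : PowObj X} (g : A ⟶ B) :
    (sigmaCone ((retr B).conj θ)).vertex ⟶ (sigmaCone ((retr A).conj θ)).vertex :=
  Quotient.lift (s := Setoid.ker ((retr A).conj θ).toFun)
    (fun x => Quotient.mk (Setoid.ker ((retr B).conj θ).toFun)
      (θ ((g : A.carrier → B.carrier) ⟨(retr A).toFun (θ.symm x), retr_mem _ _⟩).1))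
    fun x y h => by
      have h1 : (retr A).toFun (θ.symm x) = (retr A).toFun (θ.symm y) := θ.injective h
      exact congrArg (fun z : A.carrier => Quotient.mk (Setoid.ker ((retr B).conj θ).toFun)
        (θ ((g : A.carrier → B.carrier) z).1)) (Subtype.ext h1)

/-- The functor `A ↦ H(σᵉ; -)`, for `e` an idempotent transformation with image `θ(A)`. -/
def deltaPerm : PowObj X ⥤ NDual (Partn X) where
  obj A := NDual.of (sigmaCone ((retr A).conj θ)) (sigmaCone_idem (retr_conj_idem θ A))
  map {A B} g := NDual.ofHat _ _ _ _ (retrBlocks θ g)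
  map_id A := by
    refine Eq.trans ?_ (NDual.ofHat_id _ (sigmaCone_idem (retr_conj_idem θ A)))
    congr 1
    funext p
    induction p using Quotient.inductionOn with
    | h x => exact Quotient.sound (s := Setoid.ker ((retr A).conj θ).toFun) (retr_conj_idem θ A x)
  map_comp {A B D} g k := by
    refine Eq.trans ?_ (NDual.ofHat_comp _ _ _ _ (sigmaCone_idem (retr_conj_idem θ B)) _ _ _)
    congr 1
    funext p
    induction p using Quotient.inductionOn with
    | h x =>
      refine congrArg (fun y => Quotient.mk (Setoid.ker ((retr D).conj θ).toFun)
        (θ ((k : B.carrier → D.carrier) y).1)) (Subtype.ext ?_)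
      change _ = (retr B).toFun (θ.symm (θ _))
      rw [θ.symm_apply_apply, retr_of_mem (Subtype.property _)]

variable {θ}

/-- Since `θ(A)` and `θ(B)` are transversals of the two kernel partitions, a block map carries the
same data as a map `A → B`. -/
theorem retrBlocks_injective {A B : PowObj X} :
    Function.Injective (retrBlocks θ : (A ⟶ B) → _) := by
  intro g g' h
  funext x
  have h1 : Setoid.ker ((retr B).conj θ).toFun _ _ :=
    Quotient.exact (congrFun h (Quotient.mk _ (θ x.1)))
  have h2 : (⟨(retr A).toFun (θ.symm (θ x.1)), retr_mem _ _⟩ : A.carrier) = x :=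
    Subtype.ext ((congrArg (retr A).toFun (θ.symm_apply_apply _)).trans (retr_of_mem x.2))
  rw [h2] at h1
  have h3 : θ ((retr B).toFun (θ.symm (θ _))) = θ ((retr B).toFun (θ.symm (θ _))) := h1
  rw [θ.symm_apply_apply, θ.symm_apply_apply, retr_of_mem (Subtype.property _),
    retr_of_mem (Subtype.property _)] at h3
  exact Subtype.ext (θ.injective h3)

theorem retrBlocks_surjective {A B : PowObj X} :
    Function.Surjective (retrBlocks θ : (A ⟶ B) → _) := by
  intro w
  let w' : Quotient (Setoid.ker ((retr A).conj θ).toFun) →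
    Quotient (Setoid.ker ((retr B).conj θ).toFun) := w
  refine ⟨fun x => ⟨(retr B).toFun (θ.symm (w' (Quotient.mk _ (θ x.1))).out), retr_mem _ _⟩, ?_⟩
  funext p
  induction p using Quotient.inductionOn with
  | h x =>
    have h1 : Quotient.mk (Setoid.ker ((retr A).conj θ).toFun)
        (θ ((retr A).toFun (θ.symm x))) = Quotient.mk _ x :=
      Quotient.sound (retr_conj_idem θ A x)
    change Quotient.mk (Setoid.ker ((retr B).conj θ).toFun) (θ ((retr B).toFun (θ.symm
      (w' (Quotient.mk _ (θ ((retr A).toFun (θ.symm x))))).out))) = w' (Quotient.mk _ x)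
    rw [h1]
    conv_rhs => rw [← Quotient.out_eq (w' (Quotient.mk _ x))]
    exact Quotient.sound (retr_conj_idem θ B _)

/-- Conjugating by `θ` turns the condition of `mem_hSet_sigmaCone` into the one that describes
`Γ_θ(A, P)`, which makes the duality possible. -/
theorem mem_deltaPerm {A : PowObj X} {P : Partn X} {τ : NormalCone (Partn X)} :
    τ ∈ ((deltaPerm θ).obj A).toSet P ↔
      ∃ a : Sing X, τ = sigmaCone (a.conj θ) ∧ a.FactorsThrough θ A P := by
  refine mem_hSet_sigmaCone.trans ?_
  constructor
  · rintro ⟨b, rfl, h1, h2⟩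
    refine ⟨b.conj θ.symm, by rw [b.conj_symm_conj], fun x => ?_, fun x y hxy => ?_⟩
    · obtain ⟨z, hz⟩ := h1 (θ x)
      change θ.symm (b.toFun (θ x)) ∈ _
      rw [← hz]
      change θ.symm (θ _) ∈ _
      rw [θ.symm_apply_apply]
      exact retr_mem _ _
    · exact congrArg θ.symm (h2 _ _ hxy)
  · rintro ⟨a, rfl, h1, h2⟩
    refine ⟨_, rfl, fun x => ⟨θ (a.toFun (θ.symm x)), ?_⟩, fun x y hxy => ?_⟩
    · change θ ((retr A).toFun (θ.symm (θ _))) = θ _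
      rw [θ.symm_apply_apply, retr_of_mem (h1 _)]
    · refine congrArg θ (h2 _ _ ?_)
      rwa [θ.apply_symm_apply, θ.apply_symm_apply]

theorem deltaPerm_map_app {A B : PowObj X} (g : A ⟶ B) {P : Partn X} {a : Sing X}
    (h : sigmaCone (a.conj θ) ∈ ((deltaPerm θ).obj A).toSet P) (ha : a.FactorsThrough θ A P)
    (b : Sing X)
    (hb : ∀ x, ((g : A.carrier → B.carrier) ⟨a.toFun x, ha.1 x⟩).1 = b.toFun x) :
    (NDual.app ((deltaPerm θ).map g) P ⟨sigmaCone (a.conj θ), h⟩).1 = sigmaCone (b.conj θ) := by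
  let f : (sigmaCone ((retr A).conj θ)).vertex ⟶ P :=
    Quotient.lift (s := P.rel) (fun x => Quotient.mk (Setoid.ker ((retr A).conj θ).toFun)
      (θ (a.toFun (θ.symm x)))) fun x y hxy => by
        rw [ha.2 (θ.symm x) (θ.symm y) (by rwa [θ.apply_symm_apply, θ.apply_symm_apply])]
  have hτ : sigmaCone (a.conj θ) = (sigmaCone ((retr A).conj θ)).star (epiPart f) := by
    refine (sigmaCone_star _ (a.conj θ) f fun x y hxy => ?_).symm
    have h1 : Setoid.ker ((retr A).conj θ).toFun (θ (a.toFun (θ.symm x))) y := Quotient.exact hxy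
    refine Eq.trans h1.symm ?_
    change θ ((retr A).toFun (θ.symm (θ _))) = θ _
    rw [θ.symm_apply_apply, retr_of_mem (ha.1 _)]
  have hτ' : (⟨sigmaCone (a.conj θ), h⟩ : ((deltaPerm θ).obj A).toSet P) = ⟨_, f, rfl⟩ :=
    Subtype.ext hτ
  rw [hτ']
  refine (NDual.ofHat_apply _ _ _ _ _ f).trans
    (sigmaCone_star _ (b.conj θ) _ fun x y hxy => ?_)
  have h1 : Setoid.ker ((retr B).conj θ).toFun (θ ((g : A.carrier → B.carrier)
      ⟨(retr A).toFun (θ.symm (θ (a.toFun (θ.symm x)))), retr_mem _ _⟩).1) y :=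
    Quotient.exact hxy
  have h2 : (⟨(retr A).toFun (θ.symm (θ (a.toFun (θ.symm x)))), retr_mem _ _⟩ : A.carrier) =
      ⟨a.toFun (θ.symm x), ha.1 _⟩ :=
    Subtype.ext ((congrArg (retr A).toFun (θ.symm_apply_apply _)).trans (retr_of_mem (ha.1 _)))
  rw [h2] at h1
  refine Eq.trans h1.symm ?_
  change θ ((retr B).toFun (θ.symm (θ _))) = θ _
  rw [θ.symm_apply_apply, retr_of_mem (Subtype.property _), hb]

theorem mem_mSet_deltaPerm {A : PowObj X} {P : Partn X} :
    P ∈ ((deltaPerm θ).obj A).mSet ↔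
      Function.Bijective (fun x : A.carrier => Quotient.mk P.rel (θ x.1)) := by
  refine (NDual.mem_mSet_of _ (sigmaCone_idem (retr_conj_idem θ A)) _).trans ?_
  let k : A.carrier → Quotient (Setoid.ker ((retr A).conj θ).toFun) :=
    fun x => Quotient.mk _ (θ x.1)
  have hk : Function.Bijective k := by
    constructor
    · intro x y h
      have h1 : Setoid.ker ((retr A).conj θ).toFun (θ x.1) (θ y.1) := Quotient.exact h
      have h2 : θ ((retr A).toFun (θ.symm (θ x.1))) = θ ((retr A).toFun (θ.symm (θ y.1))) := h1
      rw [θ.symm_apply_apply, θ.symm_apply_apply, retr_of_mem x.2, retr_of_mem y.2] at h2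
      exact Subtype.ext (θ.injective h2)
    · intro p
      induction p using Quotient.inductionOn with
      | h x => exact ⟨⟨(retr A).toFun (θ.symm x), retr_mem _ _⟩,
          Quotient.sound (retr_conj_idem θ A x)⟩
  have h1 : (fun x : A.carrier => Quotient.mk P.rel (θ x.1)) =
      ((sigmaCone ((retr A).conj θ)).app P :
        Quotient (Setoid.ker ((retr A).conj θ).toFun) → Quotient P.rel) ∘ k := by
    funext x
    change _ = Quotient.mk P.rel (θ ((retr A).toFun (θ.symm (θ x.1))))
    rw [θ.symm_apply_apply, retr_of_mem x.2]
  rw [h1]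
  exact Iff.trans ⟨fun h => Partn.bijective_of_isIso _ h, fun h => Partn.isIso_of_bijective _ h⟩
    (Function.Bijective.of_comp_iff _ hk).symm

theorem deltaPerm_map_incl {A B : PowObj X} (h : A ≤ B) :
    ∃ k : (deltaPerm θ).obj A ≤ (deltaPerm θ).obj B,
      (deltaPerm θ).map (SubobjCat.incl h) = SubobjCat.incl k := by
  have k : (deltaPerm θ).obj A ≤ (deltaPerm θ).obj B := by
    intro P τ hτ
    rw [mem_deltaPerm] at hτ ⊢
    obtain ⟨a, rfl, ha⟩ := hτ
    exact ⟨a, rfl, fun x => h (ha.1 x), ha.2⟩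
  refine ⟨k, NDual.hom_ext' ?_⟩
  rintro P ⟨τ, hτ⟩
  obtain ⟨a, rfl, ha⟩ := mem_deltaPerm.1 hτ
  exact deltaPerm_map_app _ hτ ha a fun x => rfl

/-- Constant transformations detect the points of `A`. The bound `D` supplies the common proper
subset: for two-element `X` the two singletons have the same image. -/
theorem le_of_deltaPerm_obj_le [Nontrivial X] {A B D : PowObj X} (hA : A ≤ D) (hB : B ≤ D)
    (h : (deltaPerm θ).obj A ≤ (deltaPerm θ).obj B) : A ≤ B := by
  intro y hy
  have h1 : sigmaCone ((Sing.const y).conj θ) ∈ ((deltaPerm θ).obj A).toSet Partn.top :=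
    mem_deltaPerm.2 ⟨_, rfl, fun _ => hy, fun _ _ _ => rfl⟩
  obtain ⟨a, h2, ha⟩ := mem_deltaPerm.1 (h _ h1)
  rw [← sigmaCone_conj_inj θ (A := D) (fun _ => hA hy) (fun x => hB (ha.1 x)) h2] at ha
  exact ha.1 y

theorem deltaPerm_isCrossConnection [Nontrivial X] : IsCrossConnection (deltaPerm θ) where
  localIso :=
    { map_incl := deltaPerm_map_incl
      full := ⟨fun {A B} σ => by
        obtain ⟨w, hw⟩ := NDual.ofHat_surjective _ _ (sigmaCone_idem (retr_conj_idem θ A))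
          (sigmaCone_idem (retr_conj_idem θ B)) σ
        obtain ⟨g, rfl⟩ := retrBlocks_surjective w
        exact ⟨g, hw⟩⟩
      faithful := ⟨fun h => retrBlocks_injective (NDual.ofHat_injective _ _ _ _ h)⟩
      ideal := by
        intro A
        refine ⟨fun B hB => (deltaPerm_map_incl hB).choose, fun B hB D hD h =>
          le_antisymm (le_of_deltaPerm_obj_le hB hD h.le) (le_of_deltaPerm_obj_le hD hB h.ge), ?_⟩
        rintro ⟨_, ε, hε, rfl⟩ hF
        have h1 := (NDual.of_le_iff ε hε ((deltaPerm θ).obj A)).1 hF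
        obtain ⟨a, rfl, ha⟩ := mem_deltaPerm.1 h1
        refine ⟨⟨Set.range a.toFun, ?_, fun h => a.not_surjective (Set.range_eq_univ.1 h)⟩, ?_, ?_⟩
        · exact Set.range_nonempty _
        · rintro _ ⟨x, rfl⟩
          exact ha.1 x
        · apply NDual.ext
          funext P
          ext τ
          rw [mem_deltaPerm]
          refine Iff.trans ?_ mem_hSet_sigmaCone.symm
          constructor
          · rintro ⟨b, rfl, h1, h2⟩
            refine ⟨_, rfl, fun x => ?_, fun x y hxy => congrArg θ (h2 _ _ ?_)⟩
            · obtain ⟨z, hz⟩ := h1 (θ.symm x)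
              refine ⟨θ z, ?_⟩
              change θ (a.toFun (θ.symm (θ z))) = θ _
              rw [θ.symm_apply_apply, hz]
            · rwa [θ.apply_symm_apply, θ.apply_symm_apply]
          · rintro ⟨b, rfl, h1, h2⟩
            refine ⟨b.conj θ.symm, by rw [b.conj_symm_conj], fun x => ?_,
              fun x y hxy => congrArg θ.symm (h2 _ _ hxy)⟩
            obtain ⟨z, hz⟩ := h1 (θ x)
            refine ⟨θ.symm z, ?_⟩
            change _ = θ.symm (b.toFun (θ x))
            rw [← hz]
            exact (θ.symm_apply_apply _).symm }
  total P := by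
    obtain ⟨y⟩ := P.nonempty
    -- A transversal of `θ⁻¹(P)` is carried by `θ` to one of `P`; the point `y` serves only to
    -- invoke the lemma.
    obtain ⟨A, -, hA⟩ := PowObj.exists_transversal ((permFunctor θ).obj P) y
    exact ⟨A, mem_mSet_deltaPerm.2 ((permBlocks θ P).bijective.comp hA)⟩

end Delta

/-! ### Naturality of a duality in each variable separately. -/

section Naturality

variable {C D : Type u} [SmallCategory C] [SubobjCat C] [NormalCat C]
  [SmallCategory D] [SubobjCat D] [NormalCat D] {Γ : D ⥤ NDual C} {Δ : C ⥤ NDual D}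

theorem dualityMap_left (χ : bifunctor Γ ≅ dualBifunctor Δ) {c c' : C} (f : c ⟶ c') (d : D)
    {γ : NormalCone C} (h : γ ∈ (Γ.obj d).toSet c) :
    dualityMap χ c' d ⟨γ.push ((Γ.obj d).vertex_le h) f, (Γ.obj d).push_mem h f⟩ =
      NDual.app (Δ.map f) d (dualityMap χ c d ⟨γ, h⟩) := by
  have h1 := ConcreteCategory.congr_hom
    (χ.hom.naturality ((f, 𝟙 d) : ((c, d) : C × D) ⟶ (c', d))) (⟨γ, h⟩ : (Γ.obj d).toSet c)
  have h2 : (dualBifunctor Δ).map ((f, 𝟙 d) : ((c, d) : C × D) ⟶ (c', d)) =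
      (Δ.map f).hom.app d := by
    simp [dualBifunctor, NDual.ι]
  have h3 : (bifunctor Γ).map ((f, 𝟙 d) : ((c, d) : C × D) ⟶ (c', d)) =
      (Γ.obj d).functor.map f := by
    refine (congrArg (fun k : (Γ.obj d).functor ⟶ (Γ.obj d).functor =>
      (Γ.obj d).functor.map f ≫ k.app c') ((Γ ⋙ NDual.ι C).map_id d)).trans ?_
    exact Category.comp_id ((Γ.obj d).functor.map f)
  rw [h2, h3] at h1
  exact h1

theorem dualityMap_right (χ : bifunctor Γ ≅ dualBifunctor Δ) (c : C) {d d' : D} (g : d ⟶ d')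
    {γ : NormalCone C} (h : γ ∈ (Γ.obj d).toSet c) :
    (dualityMap χ c d' (NDual.app (Γ.map g) c ⟨γ, h⟩)).1 =
      (dualityMap χ c d ⟨γ, h⟩).1.push
        ((Δ.obj c).vertex_le (dualityMap χ c d ⟨γ, h⟩).2) g := by
  have h1 := ConcreteCategory.congr_hom
    (χ.hom.naturality ((𝟙 c, g) : ((c, d) : C × D) ⟶ (c, d'))) (⟨γ, h⟩ : (Γ.obj d).toSet c)
  have h2 : (dualBifunctor Δ).map ((𝟙 c, g) : ((c, d) : C × D) ⟶ (c, d')) =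
      (Δ.obj c).functor.map g := by
    refine (congrArg (fun k : (Δ.obj c).functor ⟶ (Δ.obj c).functor =>
      k.app d ≫ (Δ.obj c).functor.map g) ((Δ ⋙ NDual.ι D).map_id c)).trans ?_
    exact Category.id_comp ((Δ.obj c).functor.map g)
  have h3 : (bifunctor Γ).map ((𝟙 c, g) : ((c, d) : C × D) ⟶ (c, d')) =
      (Γ.map g).hom.app c := by
    simp [bifunctor, NDual.ι]
  rw [h2, h3] at h1
  exact congrArg Subtype.val h1

/-- An inclusion acts trivially on cones, and `Δ` preserves inclusions, so naturality shows that the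
image does not change when the object is enlarged. -/
theorem IsDual.dualityMap_of_le {χ : bifunctor Γ ≅ dualBifunctor Δ} (H : IsDual Γ Δ χ) {A B : C}
    (h : A ≤ B) {P : D} {γ : NormalCone C} (hγ : γ ∈ (Γ.obj P).toSet A)
    (hγ' : γ ∈ (Γ.obj P).toSet B) :
    (dualityMap χ B P ⟨γ, hγ'⟩).1 = (dualityMap χ A P ⟨γ, hγ⟩).1 := by
  have h1 := dualityMap_left χ (SubobjCat.incl h) P hγ
  obtain ⟨k, hk⟩ := H.cross.localIso.map_incl h
  rw [hk] at h1
  simp only [NormalCone.push_incl] at h1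
  exact congrArg Subtype.val h1

end Naturality

variable {θ : Equiv.Perm X}

theorem Sing.exists_iff_not_bijective [Finite X] (f : X → X) :
    (∃ a : Sing X, a.toFun = f) ↔ ¬ Function.Bijective f := by
  constructor
  · rintro ⟨a, rfl⟩ h
    exact a.not_injective h.1
  · intro h
    exact ⟨⟨f, fun h1 => h (Finite.injective_iff_bijective.1 h1),
      fun h1 => h (Finite.surjective_iff_bijective.1 h1)⟩, rfl⟩

/-- Pushing along the constant block map with value `[x]` evaluates all components of `τ` at `[x]`;
hence `z` is arbitrary. -/
theorem Partn.block_eq_of_push {τ τ' : NormalCone (Partn X)} {P Q : Partn X} (h : τ.vertex ≤ P)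
    (x : X) (h' : τ.push h (fun _ => Quotient.mk P.rel x : P ⟶ Q) = τ') (R : Partn X) (z : X) :
    (τ.app R : Quotient τ.vertex.rel → Quotient R.rel) (Quotient.mk _ x) =
      (τ'.app R : Quotient τ'.vertex.rel → Quotient R.rel) (Quotient.mk _ z) := by
  subst h'
  refine congrArg (τ.app R : Quotient τ.vertex.rel → Quotient R.rel) ?_
  exact (Partn.epiPart_mk (SubobjCat.incl h ≫ (fun _ => Quotient.mk P.rel x : P ⟶ Q)) z).symm

variable [Nontrivial X]

/-! ### The duality -/

variable (θ) in
/-- The map `ρᵃ ↦ σ^{θ⁻¹aθ}`. -/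
def rhoToSigma (A : PowObj X) (P : Partn X) (γ : ((gammaPerm θ).obj P).toSet A) :
    ((deltaPerm θ).obj A).toSet P :=
  ⟨sigmaCone ((exists_eq_rhoCone γ.1).choose.conj θ), mem_deltaPerm.2 ⟨_, rfl,
    rhoCone_mem_gammaPerm.1 ((exists_eq_rhoCone γ.1).choose_spec ▸ γ.2)⟩⟩

theorem rhoToSigma_apply {A : PowObj X} {P : Partn X} {a : Sing X}
    (γ : ((gammaPerm θ).obj P).toSet A) (h : γ.1 = rhoCone a) :
    (rhoToSigma θ A P γ).1 = sigmaCone (a.conj θ) :=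
  congrArg (fun b : Sing X => sigmaCone (b.conj θ))
    (rhoCone_injective ((exists_eq_rhoCone γ.1).choose_spec.symm.trans h))

theorem rhoToSigma_bijective (A : PowObj X) (P : Partn X) :
    Function.Bijective (rhoToSigma θ A P) := by
  constructor
  · rintro ⟨γ, h⟩ ⟨γ', h'⟩ hh
    obtain ⟨a, rfl⟩ := exists_eq_rhoCone γ
    obtain ⟨b, rfl⟩ := exists_eq_rhoCone γ'
    have h1 := congrArg Subtype.val hh
    rw [rhoToSigma_apply _ rfl, rhoToSigma_apply _ rfl] at h1
    apply Subtype.ext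
    exact congrArg rhoCone (sigmaCone_conj_inj θ (rhoCone_mem_gammaPerm.1 h).1
      (rhoCone_mem_gammaPerm.1 h').1 h1)
  · rintro ⟨δ, h⟩
    obtain ⟨a, rfl, ha⟩ := mem_deltaPerm.1 h
    exact ⟨⟨rhoCone a, rhoCone_mem_gammaPerm.2 ha⟩, Subtype.ext (rhoToSigma_apply _ rfl)⟩

variable (θ) in
/-- The duality `ρᵃ ↦ σ^{θ⁻¹aθ}` between `Γ_θ` and its dual. -/
def permDuality : bifunctor (gammaPerm θ) ≅ dualBifunctor (deltaPerm θ) :=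
  NatIso.ofComponents
    (fun p => Equiv.toIso (X := ((gammaPerm θ).obj p.2).toSet p.1)
      (Y := ((deltaPerm θ).obj p.1).toSet p.2)
      (Equiv.ofBijective (rhoToSigma θ p.1 p.2) (rhoToSigma_bijective p.1 p.2))) (by
    rintro ⟨A, P⟩ ⟨B, Q⟩ ⟨f, η⟩
    ext ⟨γ, hγ⟩
    obtain ⟨a, rfl⟩ := exists_eq_rhoCone γ
    have ha := rhoCone_mem_gammaPerm.1 hγ
    -- Here `b` is `a` followed by `f`, and `d` below is `b` transported along `η`. Both routes
    -- round the naturality square end at the `σ`-cone of the conjugate of `d`.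
    let b : Sing X := Sing.ofFactor ((permFunctor θ).obj P) B.carrier B.ne_univ
      (fun x => ((f : A.carrier → B.carrier) ⟨a.toFun x, ha.1 x⟩).1) (fun x => Subtype.property _)
      fun x y hxy => by
        have h1 := ha.2 x y hxy
        simp only [h1]
    have hb : b.FactorsThrough θ B P := ⟨fun x => Subtype.property _, fun x y hxy => by
        have h1 := ha.2 x y hxy
        change ((f : A.carrier → B.carrier) ⟨a.toFun x, _⟩).1 =
          ((f : A.carrier → B.carrier) ⟨a.toFun y, _⟩).1
        simp only [h1]⟩
    let η' : Quotient Q.rel → Quotient P.rel := η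
    let d : Sing X := Sing.ofFactor ((permFunctor θ).obj Q) B.carrier B.ne_univ
      (fun x => b.toFun (θ.symm (η' (Quotient.mk _ (θ x))).out)) (fun x => hb.1 _)
      fun x y hxy => by
        have h1 : Quotient.mk Q.rel (θ x) = Quotient.mk Q.rel (θ y) := Quotient.sound hxy
        simp only [h1]
    have hd : ∀ x y, η' (Quotient.mk _ (θ x)) = Quotient.mk _ (θ y) →
        b.toFun y = d.toFun x := by
      intro x y hxy
      refine hb.2 _ _ ?_
      rw [hxy, θ.apply_symm_apply]
      exact P.rel.symm (Quotient.exact (Quotient.out_eq (Quotient.mk P.rel (θ y))))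
    have hd' : ∀ x y, η' (Quotient.mk _ x) = Quotient.mk _ y →
        (b.conj θ).toFun y = (d.conj θ).toFun x := by
      intro x y hxy
      refine congrArg θ (hd _ _ ?_)
      rwa [θ.apply_symm_apply, θ.apply_symm_apply]
    have h1 : (rhoCone a).push (NDual.vertex_le _ hγ) f = rhoCone b :=
      rhoCone_push a b _ f fun x => rfl
    have h2 : rhoCone b ∈ ((gammaPerm θ).obj P).toSet B := rhoCone_mem_gammaPerm.2 hb
    have h3 : (⟨_, NDual.push_mem _ hγ f⟩ : ((gammaPerm θ).obj P).toSet B) = ⟨rhoCone b, h2⟩ :=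
      Subtype.ext h1
    have h4 : (rhoToSigma θ B Q (NDual.app ((gammaPerm θ).map η) B
        ⟨_, NDual.push_mem _ hγ f⟩)).1 = sigmaCone (d.conj θ) :=
      rhoToSigma_apply _ (by rw [h3, gammaPerm_map_app η h2 d hd])
    have h5 : (rhoToSigma θ A P ⟨rhoCone a, hγ⟩) = ⟨sigmaCone (a.conj θ),
        mem_deltaPerm.2 ⟨a, rfl, ha⟩⟩ := Subtype.ext (rhoToSigma_apply _ rfl)
    have h6 : (NDual.app ((deltaPerm θ).map f) P (rhoToSigma θ A P ⟨rhoCone a, hγ⟩)).1 =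
        sigmaCone (b.conj θ) := by
      rw [h5]
      exact deltaPerm_map_app f _ ha b fun x => rfl
    have h7 : ∀ (τ : NormalCone (Partn X)) (hτ : τ.vertex ≤ P), τ = sigmaCone (b.conj θ) →
        τ.push hτ η = sigmaCone (d.conj θ) := by
      rintro _ hτ rfl
      exact sigmaCone_push _ _ hτ η hd'
    exact Subtype.ext (h4.trans (h7 _ _ h6).symm))

theorem dualityMap_permDuality (A : PowObj X) (P : Partn X)
    (γ : ((gammaPerm θ).obj P).toSet A) :
    dualityMap (permDuality θ) A P γ = rhoToSigma θ A P γ :=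
  rfl

theorem isDual_deltaPerm : IsDual (gammaPerm θ) (deltaPerm θ) (permDuality θ) where
  cross := deltaPerm_isCrossConnection
  mem_mSet A P := mem_mSet_gammaPerm.trans mem_mSet_deltaPerm.symm
  map_idem := by
    rintro A P ⟨γ, hγ⟩ ⟨δ, hδ⟩ h1 h2 - h3 h4 -
    rw [dualityMap_permDuality]
    obtain ⟨a, rfl⟩ := exists_eq_rhoCone γ
    obtain ⟨b, rfl, hb⟩ := mem_deltaPerm.1 hδ
    have ha := rhoCone_mem_gammaPerm.1 hγ
    refine Subtype.ext ((rhoToSigma_apply _ rfl).trans ?_)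
    change sigmaCone _ = sigmaCone _
    congr 2
    have h5 : a * a = a := rhoCone_injective ((rhoCone_mul a a).symm.trans h1)
    have h6 : b * b = b := by
      refine sigmaCone_conj_inj θ (fun x => hb.1 _) hb.1 ?_
      rw [Sing.conj_mul, ← sigmaCone_mul]
      exact h3
    have ha' : ∀ x ∈ A.carrier, a.toFun x = x := by
      intro x hx
      rw [← h2] at hx
      obtain ⟨y, rfl⟩ := hx
      exact congrFun (congrArg Sing.toFun h5) y
    apply Sing.ext
    funext x
    -- The value of `b` at `x` lies in `A`, so `a` fixes it. As `b` is idempotent and its conjugate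
    -- has kernel `P`, the points `x` and `b(x)` share a block of `θ⁻¹(P)`, on which `a` is
    -- constant.
    rw [← ha' _ (hb.1 x)]
    refine ha.2 _ _ ?_
    rw [← h4]
    change θ (b.toFun (θ.symm (θ x))) = θ (b.toFun (θ.symm (θ (b.toFun x))))
    rw [θ.symm_apply_apply, θ.symm_apply_apply]
    exact congrArg θ (congrFun (congrArg Sing.toFun h6) x).symm

/-! ### Uniqueness of the duality -/

section Unique

variable {Δ : PowObj X ⥤ NDual (Partn X)} {χ : bifunctor (gammaPerm θ) ≅ dualBifunctor Δ}

/-- The image of the constant cone at `y` under a duality. -/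
def constImage (χ : bifunctor (gammaPerm θ) ≅ dualBifunctor Δ) (y : X) : NormalCone (Partn X) :=
  (dualityMap χ (PowObj.single y) Partn.top ⟨rhoCone (Sing.const y),
    rhoCone_mem_gammaPerm.2 ⟨fun _ => rfl, fun _ _ _ => rfl⟩⟩).1

/-- Along the constant block map at `[x]`, `Γ_θ` sends `ρᵃ` to the constant cone at `a(θ⁻¹x)`, while
`Δ` evaluates at `[x]`. The constant cone is then moved from `A` to a singleton. -/
theorem IsDual.app_dualityMap (H : IsDual (gammaPerm θ) Δ χ) {A : PowObj X} {P : Partn X}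
    {a : Sing X} (h : rhoCone a ∈ ((gammaPerm θ).obj P).toSet A) (R : Partn X) (x z : X) :
    ((dualityMap χ A P ⟨rhoCone a, h⟩).1.app R :
      Quotient (dualityMap χ A P ⟨rhoCone a, h⟩).1.vertex.rel → Quotient R.rel)
        (Quotient.mk _ x) =
      ((constImage χ (a.toFun (θ.symm x))).app R :
        Quotient (constImage χ (a.toFun (θ.symm x))).vertex.rel → Quotient R.rel)
          (Quotient.mk _ z) := by
  have ha := rhoCone_mem_gammaPerm.1 h
  have h1 := dualityMap_right χ A (fun _ => Quotient.mk P.rel x : P ⟶ Partn.top) h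
  refine Partn.block_eq_of_push _ x (h1.symm.trans ?_) R z
  have hc : rhoCone (Sing.const (a.toFun (θ.symm x))) ∈
      ((gammaPerm θ).obj Partn.top).toSet A :=
    rhoCone_mem_gammaPerm.2 ⟨fun _ => ha.1 _, fun _ _ _ => rfl⟩
  have h2 : NDual.app ((gammaPerm θ).map (fun _ => Quotient.mk P.rel x : P ⟶ Partn.top)) A
      ⟨rhoCone a, h⟩ = ⟨rhoCone (Sing.const (a.toFun (θ.symm x))), hc⟩ := by
    refine Subtype.ext (gammaPerm_map_app _ h _ fun v w hvw => ?_)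
    refine ha.2 _ _ ?_
    rw [θ.apply_symm_apply]
    exact P.rel.symm (Quotient.exact (s := P.rel) hvw)
  rw [h2]
  refine H.dualityMap_of_le (A := PowObj.single (a.toFun (θ.symm x))) ?_ _ hc
  rintro _ rfl
  exact ha.1 _

/-- Take a transversal `A` of `θ⁻¹(P)` through `y`. The duality sends the idempotent cone at `(A,
P)` to a cone that is the identity at `P`; evaluate it at `[θ(y)]`, using that the idempotent fixes
`y`. -/
theorem IsDual.app_constImage (H : IsDual (gammaPerm θ) Δ χ) (y z : X) (P : Partn X) :
    ((constImage χ y).app P : Quotient (constImage χ y).vertex.rel → Quotient P.rel)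
      (Quotient.mk _ z) = Quotient.mk _ (θ y) := by
  obtain ⟨A, hy, hA⟩ := PowObj.exists_transversal ((permFunctor θ).obj P) y
  have hA' : A ∈ ((gammaPerm θ).obj P).mSet :=
    mem_mSet_gammaPerm.2 ((permBlocks θ P).bijective.comp hA)
  obtain ⟨γ, hv, h1, h2, h3⟩ := NDual.exists_of_mem_mSet hA'
  obtain ⟨δ, hv', h1', h2', h3'⟩ := NDual.exists_of_mem_mSet ((H.mem_mSet A P).1 hA')
  obtain ⟨a, rfl⟩ := exists_eq_rhoCone γ
  have hγ : rhoCone a ∈ ((gammaPerm θ).obj P).toSet A := by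
    rw [h2]
    exact NormalCone.mem_hSet_of_le _ hv.le
  have hδ : δ ∈ (Δ.obj A).toSet P := by
    rw [h2']
    exact NormalCone.mem_hSet_of_le _ hv'.le
  have h4 := H.map_idem A P ⟨_, hγ⟩ ⟨_, hδ⟩ h1 hv h2 h1' hv' h2'
  have h5 := H.app_dualityMap hγ P (θ y) z
  have hay : a.toFun y = y := by
    obtain ⟨x, rfl⟩ : y ∈ Set.range a.toFun := by
      have h6 := hy
      rw [← hv] at h6
      exact h6
    exact congrFun (congrArg Sing.toFun (rhoCone_injective ((rhoCone_mul a a).symm.trans h1))) x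
  rw [h4, h3', θ.symm_apply_apply, hay] at h5
  rw [← h5]
  exact Partn.eqToHom_mk hv'.symm (θ y)

/-- Every duality between `Γ_θ` and a dual cross-connection is given by `ρᵃ ↦ σ^{θ⁻¹aθ}`. -/
theorem IsDual.dualityMap_rhoCone (H : IsDual (gammaPerm θ) Δ χ) {A : PowObj X} {P : Partn X}
    {a : Sing X} (h : rhoCone a ∈ ((gammaPerm θ).obj P).toSet A) :
    (dualityMap χ A P ⟨rhoCone a, h⟩).1 = sigmaCone (a.conj θ) :=
  eq_sigmaCone _ _ fun R x => (H.app_dualityMap h R x x).trans (H.app_constImage _ x R)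

theorem IsDual.linkedPairs_eq (H : IsDual (gammaPerm θ) Δ χ) :
    linkedPairs χ =
      Set.range (fun a : Sing X => (rhoCone a, MulOpposite.op (sigmaCone (a.conj θ)))) := by
  ext ⟨γ, δ⟩
  constructor
  · rintro ⟨-, -, A, P, h, hδ⟩
    obtain ⟨a, rfl⟩ := exists_eq_rhoCone γ
    refine ⟨a, Prod.ext rfl (MulOpposite.unop_injective ?_)⟩
    exact (hδ.trans (H.dualityMap_rhoCone h)).symm
  · rintro ⟨a, h⟩
    obtain ⟨rfl, rfl⟩ := Prod.ext_iff.1 h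
    have := a.nonempty
    -- The image of `a` and the kernel of its conjugate give a pair `(A, P)` with `ρᵃ` in `Γ_θ(A,
    -- P)`.
    let A : PowObj X := ⟨Set.range a.toFun, Set.range_nonempty _,
      fun h => a.not_surjective (Set.range_eq_univ.1 h)⟩
    let P : Partn X := ⟨Setoid.ker (a.conj θ).toFun,
      fun h => (a.conj θ).not_injective (Setoid.ker_eq_bot_iff.1 h)⟩
    have hγ : rhoCone a ∈ ((gammaPerm θ).obj P).toSet A := by
      refine rhoCone_mem_gammaPerm.2 ⟨fun x => ⟨x, rfl⟩, fun x y hxy => ?_⟩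
      have h1 : θ (a.toFun (θ.symm (θ x))) = θ (a.toFun (θ.symm (θ y))) := hxy
      rw [θ.symm_apply_apply, θ.symm_apply_apply] at h1
      exact θ.injective h1
    have hδ := H.dualityMap_rhoCone hγ
    refine ⟨Set.mem_iUnion₂.2 ⟨A, P, hγ⟩, ?_, A, P, hγ, hδ.symm⟩
    change sigmaCone (a.conj θ) ∈ _
    rw [← hδ]
    exact Set.mem_iUnion₂.2 ⟨P, A, Subtype.property _⟩

end Unique

/-! ### The isomorphism onto the cross-connection semigroup. -/

variable (θ) in
/-- The homomorphism `a ↦ (ρᵃ, σ^{θ⁻¹aθ})`. -/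
def permHom : Sing X →ₙ* NormalCone (PowObj X) × (NormalCone (Partn X))ᵐᵒᵖ where
  toFun a := (rhoCone a, MulOpposite.op (sigmaCone (a.conj θ)))
  map_mul' a b := by
    refine Prod.ext (rhoCone_mul a b).symm (MulOpposite.unop_injective ?_)
    change sigmaCone ((a * b).conj θ) = sigmaCone (b.conj θ) * sigmaCone (a.conj θ)
    rw [Sing.conj_mul, sigmaCone_mul]

theorem permHom_injective : Function.Injective (permHom (X := X) θ) :=
  fun _ _ h => rhoCone_injective (congrArg Prod.fst h)

end CrossConn

end

theorem mainTheorem2 (X : Type u) [Nontrivial X] (θ : Equiv.Perm X) :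
    (Finite X → ∀ f : X → X, (∃ a : Sing X, a.toFun = f) ↔ ¬ Function.Bijective f) ∧
    IsCrossConnection (gammaPerm θ) ∧
    (∃ (Δ : PowObj X ⥤ NDual (Partn X)) (χ : bifunctor (gammaPerm θ) ≅ dualBifunctor Δ),
      IsDual (gammaPerm θ) Δ χ) ∧
    ∀ (Δ : PowObj X ⥤ NDual (Partn X)) (χ : bifunctor (gammaPerm θ) ≅ dualBifunctor Δ),
      IsDual (gammaPerm θ) Δ χ →
        linkedPairs χ =
          Set.range (fun a : Sing X => (rhoCone a, MulOpposite.op (sigmaCone (a.conj θ)))) ∧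
        ∃ S : Subsemigroup (NormalCone (PowObj X) × (NormalCone (Partn X))ᵐᵒᵖ),
          (S : Set (NormalCone (PowObj X) × (NormalCone (Partn X))ᵐᵒᵖ)) = linkedPairs χ ∧
          ∃ φ : Sing X ≃* S,
            ∀ a : Sing X, (φ a).1 = (rhoCone a, MulOpposite.op (sigmaCone (a.conj θ))) := by
  refine ⟨fun _ => Sing.exists_iff_not_bijective, gammaPerm_isCrossConnection,
    ⟨deltaPerm θ, permDuality θ, isDual_deltaPerm⟩, fun Δ χ H => ⟨H.linkedPairs_eq, ?_⟩⟩
  refine ⟨(permHom θ).srange, ?_, ?_⟩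
  · rw [H.linkedPairs_eq]
    rfl
  · exact ⟨MulEquiv.ofBijective (permHom θ).srangeRestrict
      ⟨fun a b h => permHom_injective (congrArg Subtype.val h),
        MulHom.srangeRestrict_surjective _⟩, fun a => rfl⟩
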